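/- Boxes are pairs $(i,j)$ of positive integers ($i$ the row, counted from north to south, $j$ the column, counted from west to east). A moon polyomino is a finite set $M$ of boxes that is convex (if two boxes of $M$ lie in the same row or column, all boxes between them are in $M$) and intersection-free (of any two columns of $M$, viewed as sets of row indices, one contains the other). A north-east chain of length $\ell$ in $M$ is a sequence of $\ell$ boxes, each strictly north and strictly east of the preceding one, such that the smallest rectangle containing all of them is contained in $M$. For a positive integer $k$, let $\mathcal F_{NE}(M,k)$ be the set of $k$-north-east fillings of $M$: the subsets $F\subseteq M$ that contain no north-east chain in $M$ of length $k+1$ and have the largest possible number of boxes among such subsets. A pipe dream of size $n$ is a subset $D$ of the staircase $\{(i,j): i+j\le n\}$. In the boxes of $D$ two pipes cross (one passing straight from top to bottom, one from right to left); in every other box there are two turning pipes, one joining top and left, the other joining right and bottom. The permutation $\pi(D)\in S_n$ has $\pi(D)(i)=c$ if the pipe starting at the top of column $c$ ends at the left of row $i$. $D$ is reduced if any two pipes cross at most once. For a permutation $\sigma \in S_n$, let $\mathcal{RP}(\sigma,M)$ be the set of reduced pipe dreams $D$ of size $n$ with $\pi(D)=\sigma$ and $D\subseteq M$. The diagram of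 $\sigma$ is $D(\sigma)=\{(i,\sigma(j)) : i<j,\ \sigma(i)>\sigma(j)\}$, and the essential set of $\sigma$ is the set of boxes $(p,q)\in D(\sigma)$ with $(p+1,q),(p,q+1)\notin D(\sigma)$, each labelled by $r_\sigma(p,q)=\#\{i\le p : \sigma(i)\le q\}$. **Theorem.** Let $M$ be a moon polyomino, let $k$ be a positive integer, and let $n\ge 0$ be such that $M$ is contained in the staircase $\{(i,j): i+j\le n\}$. For every maximal rectangle of $M$ of width and height both strictly larger than $k$, with north-west corner box $(a+1,b+1)$ and south-east corner box $(i,j)$, mark the box $(i+b,j+a)$ with the label $a+b+k$. Then there is exactly one permutation $\sigma=\sigma_k(M)\in S_n$ whose essential set is this collection of labelled boxes, and the complementary map $F\mapsto M\setminus F$ is a bijection from $\mathcal F_{NE}(M,k)$ onto $\mathcal{RP}(\sigma,M)$. -/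

import Mathlib

namespace MoonFilling

/-- A box of the quadrant, written `(row, column)`. Rows are numbered from north to south and columns
from west to east, both starting at `0`; the box `(i, j)` is the one usually called `(i+1, j+1)`. -/
abbrev Box : Type := ℕ × ℕ

/-! ### Moon polyominoes and north-east fillings -/

/-- If two boxes of `M` lie in the same row or in the same column, then all boxes in between are
in `M`. -/
def IsConvexPolyomino (M : Finset Box) : Prop :=
  (∀ i j₁ j j₂ : ℕ, (i, j₁) ∈ M → (i, j₂) ∈ M → j₁ ≤ j → j ≤ j₂ → (i, j) ∈ M) ∧
  (∀ j i₁ i i₂ : ℕ, (i₁, j) ∈ M → (i₂, j) ∈ M → i₁ ≤ i → i ≤ i₂ → (i, j) ∈ M)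

/-- Of any two columns of `M`, viewed as sets of row indices, one is contained in the other. -/
def IsIntersectionFree (M : Finset Box) : Prop :=
  ∀ j₁ j₂ : ℕ, {i : ℕ | (i, j₁) ∈ M} ⊆ {i : ℕ | (i, j₂) ∈ M} ∨
    {i : ℕ | (i, j₂) ∈ M} ⊆ {i : ℕ | (i, j₁) ∈ M}

/-- A moon polyomino. -/
def IsMoonPolyomino (M : Finset Box) : Prop :=
  IsConvexPolyomino M ∧ IsIntersectionFree M

/-- The sequence `s` of `l` boxes is a north-east chain in `M`: every box is strictly north and
strictly east of the preceding ones, and the smallest rectangle containing all boxes of the sequence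
is contained in `M`. (The boxes themselves lie in that rectangle.) -/
def IsNEChain (M : Finset Box) {l : ℕ} (s : Fin l → Box) : Prop :=
  (∀ t u : Fin l, t < u → (s u).1 < (s t).1 ∧ (s t).2 < (s u).2) ∧
  ∀ i j : ℕ, (∃ t, (s t).1 ≤ i) → (∃ t, i ≤ (s t).1) → (∃ t, (s t).2 ≤ j) → (∃ t, j ≤ (s t).2) →
    (i, j) ∈ M

/-- A `(0,1)`-filling of `M`, identified with its set `F` of boxes filled with `1`, that has no
north-east chain of `1`s of length `k + 1`. -/
def AvoidsNEChains (M : Finset Box) (k : ℕ) (F : Finset Box) : Prop :=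
  F ⊆ M ∧ ∀ s : Fin (k + 1) → Box, (∀ t, s t ∈ F) → ¬ IsNEChain M s

/-- The set of `k`-north-east fillings of `M`: the number of `1`s is as large as possible. -/
def neFillings (M : Finset Box) (k : ℕ) : Set (Finset Box) :=
  {F | AvoidsNEChains M k F ∧ ∀ G : Finset Box, AvoidsNEChains M k G → G.card ≤ F.card}

/-! ### Pipe dreams -/

/-- The staircase shape `(n-1, …, 2, 1)`. -/
def staircase (n : ℕ) : Set Box := {x | x.1 + x.2 + 1 < n}

/-- The side through which a pipe enters a box. -/
inductive Side : Type
  | top : Side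
  | right : Side

/-- `Enters D c d i j`: in the pipe dream with set of crossings `D`, the pipe that starts at the top
of column `c` enters the box `(i, j)` through its side `d`. In a box of `D` the pipe goes straight on;
in a box outside `D` it turns: from the top to the left, or from the right to the bottom. -/
inductive Enters (D : Finset Box) (c : ℕ) : Side → ℕ → ℕ → Prop
  | start : Enters D c Side.top 0 c
  | cross_top {i j : ℕ} : (i, j) ∈ D → Enters D c Side.top i j → Enters D c Side.top (i + 1) j
  | turn_top {i j : ℕ} : (i, j + 1) ∉ D → Enters D c Side.top i (j + 1) → Enters D c Side.right i j
  | cross_right {i j : ℕ} :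
      (i, j + 1) ∈ D → Enters D c Side.right i (j + 1) → Enters D c Side.right i j
  | turn_right {i j : ℕ} : (i, j) ∉ D → Enters D c Side.right i j → Enters D c Side.top (i + 1) j

/-- The pipe that starts at the top of column `c` ends at the left side of row `i`, that is, it
leaves the box `(i, 0)` through the left. -/
def EndsAt (D : Finset Box) (c i : ℕ) : Prop :=
  ((i, 0) ∉ D ∧ Enters D c Side.top i 0) ∨ ((i, 0) ∈ D ∧ Enters D c Side.right i 0)

/-- The permutation of the pipe dream `D` is `σ`: reading, from top to bottom, the starting columns of
the pipes that end at the left of rows `0, 1, …, n-1` gives the one-line notation of `σ`. -/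
def HasPermutation {n : ℕ} (D : Finset Box) (σ : Equiv.Perm (Fin n)) : Prop :=
  ∀ i : Fin n, EndsAt D (σ i : ℕ) (i : ℕ)

/-- The pipes starting at the top of columns `c` and `c'` cross each other in the box `x`. -/
def CrossAt (D : Finset Box) (c c' : ℕ) (x : Box) : Prop :=
  x ∈ D ∧ ((Enters D c Side.top x.1 x.2 ∧ Enters D c' Side.right x.1 x.2) ∨
    (Enters D c' Side.top x.1 x.2 ∧ Enters D c Side.right x.1 x.2))

/-- Any two different pipes cross at most once. -/
def IsReduced (D : Finset Box) : Prop :=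
  ∀ c c' : ℕ, c ≠ c' → ∀ x y : Box, CrossAt D c c' x → CrossAt D c c' y → x = y

/-- The reduced pipe dreams (of size `n`) for `σ`. -/
def reducedPipeDreams {n : ℕ} (σ : Equiv.Perm (Fin n)) : Set (Finset Box) :=
  {D | (∀ x ∈ D, x ∈ staircase n) ∧ HasPermutation D σ ∧ IsReduced D}

/-- The reduced pipe dreams for `σ` that live inside `M`. -/
def reducedPipeDreamsInside {n : ℕ} (σ : Equiv.Perm (Fin n)) (M : Finset Box) :
    Set (Finset Box) :=
  {D | D ∈ reducedPipeDreams σ ∧ D ⊆ M}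

/-! ### The permutation attached to a moon polyomino -/

/-- The (Rothe) diagram of `σ`. -/
def rotheDiagram {n : ℕ} (σ : Equiv.Perm (Fin n)) : Set Box :=
  {x | ∃ i j : Fin n, i < j ∧ σ j < σ i ∧ x = ((i : ℕ), (σ j : ℕ))}

/-- The number of `(i, σ i)` lying weakly north-west of the box `(p, q)`. -/
def rankAt {n : ℕ} (σ : Equiv.Perm (Fin n)) (p q : ℕ) : ℕ :=
  (Finset.univ.filter fun i : Fin n => (i : ℕ) ≤ p ∧ (σ i : ℕ) ≤ q).card

/-- The essential set of `σ`: the south-east corner boxes `(p, q)` of the diagram, each labelled by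
the rank of `σ` at `(p, q)`. -/
def essentialSet {n : ℕ} (σ : Equiv.Perm (Fin n)) : Set (Box × ℕ) :=
  {y | ∃ p q : ℕ, (p, q) ∈ rotheDiagram σ ∧ (p + 1, q) ∉ rotheDiagram σ ∧
    (p, q + 1) ∉ rotheDiagram σ ∧ y = ((p, q), rankAt σ p q)}

/-- The (nonempty) rectangle with north-west corner box `(a, b)` and south-east corner box `(c, d)` is
a maximal rectangle in `M`. -/
def IsMaximalRectangle (M : Finset Box) (a b c d : ℕ) : Prop :=
  a ≤ c ∧ b ≤ d ∧ Finset.Icc (a, b) (c, d) ⊆ M ∧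
    ∀ a' b' c' d' : ℕ, Finset.Icc (a', b') (c', d') ⊆ M →
      Finset.Icc (a, b) (c, d) ⊆ Finset.Icc (a', b') (c', d') →
      Finset.Icc (a', b') (c', d') = Finset.Icc (a, b) (c, d)

/-- The labelled boxes coming from the maximal rectangles of `M` of height and width larger than `k`.
The rectangle with corner boxes `(a, b)` and `(c, d)` in the numbering from `0`, that is, `(a+1, b+1)`
and `(i, j) = (c+1, d+1)` in the numbering from `1`, gives the box `(c+b, d+a)`, that is,
`(i+b, j+a)` in the numbering from `1`, with label `a+b+k`. -/
def markedBoxes (M : Finset Box) (k : ℕ) : Set (Box × ℕ) :=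
  {y | ∃ a b c d : ℕ, IsMaximalRectangle M a b c d ∧ k < c + 1 - a ∧ k < d + 1 - b ∧
    y = ((c + b, d + a), a + b + k)}

end MoonFilling

/-!
The complement `D = M \ F` of a filling is read as a word in the simple transpositions: the rows
are read from top to bottom, every row from right to left, and the box `(i, j)` of `D` contributes
the transposition of the positions `i + j` and `i + j + 1`. The product of this word, `plain`,
lists the pipes in the order in which they leave `D`, and `D` is reduced exactly if every letter
creates an inversion (`IsReduced.ascending`, `Ascending.isReduced`). For an arbitrary `D` the
product is replaced by the Demazure product `sticky`, in which letters that would remove an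
inversion are skipped.

The first main point, `rk_sticky`, is that the number of `i < p` which the Demazure product maps
below `q` is the largest length of a north-east chain in the complement of `D` (within the whole
quadrant) in the first `p` rows and `q` columns: along the boundary of the region already read,
both sides satisfy the same local recursion. The second main point, `avoidsNEChains_iff`, is that
`F` contains no north-east chain of length `k + 1` in `M` exactly if these lengths, at each marked
box, are at most its label. A rectangle of `M` can contribute only `k` boxes, and the additional
`a + b` boxes of the label can always be found outside `M`, to the north-east and to the south-west
of a maximal rectangle.

If `σ` is a permutation whose essential set consists of the marked boxes, then, since ranks on the
essential set bound all ranks (`rk_le_of_essential`), `F` avoids the chains if and only if the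
Demazure product of `M \ F` has ranks bounded by those of `σ`. By `card_inversions_le` such a
complement has at least as many boxes as `σ` has inversions, with equality only for the reduced
pipe dreams of `σ`. Hence the theorem follows once `M` is known to contain one reduced pipe dream
of `σ`.

Uniqueness of `σ` again follows from `rk_le_of_essential`. For the existence of `σ` and of a pipe
dream, take the `erosion` of `M`, the set of south-west corners of squares of side length `k + 1`
in `M`. It is a moon polyomino whose maximal rectangles give the same marked boxes for `k = 0`
(`markedBoxes_erosion`). A moon polyomino is itself a reduced pipe dream
(`IsMoonPolyomino.ascending`), and the essential set of its permutation consists of the boxes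
marked by its maximal rectangles (`IsMoonPolyomino.isEssential_iff`); the hard direction is
`IsMoonPolyomino.exists_hasRectangle`, which finds a rectangle in `M` wherever the chains outside
`M` are short.
-/

namespace MoonFilling

open Finset Equiv

/-! ### Rank functions and inversions of permutations -/

/-- The number of positions `i < p` with `w i < q`. -/
def rk (w : Perm ℕ) (p q : ℕ) : ℕ := ∑ i ∈ range p, if w i < q then 1 else 0

lemma rk_zero (w : Perm ℕ) (q : ℕ) : rk w 0 q = 0 := rfl

lemma rk_succ (w : Perm ℕ) (p q : ℕ) : rk w (p + 1) q = rk w p q + if w p < q then 1 else 0 :=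
  sum_range_succ _ _

lemma rk_congr {w w' : Perm ℕ} {p : ℕ} (q : ℕ) (h : ∀ i < p, w i = w' i) :
    rk w p q = rk w' p q :=
  sum_congr rfl fun i hi => by rw [h i (mem_range.1 hi)]

lemma rk_one (p q : ℕ) : rk 1 p q = min p q := by
  induction p with
  | zero => simp [rk_zero]
  | succ p ih => rw [rk_succ, ih, Perm.one_apply]; split_ifs <;> omega

lemma eq_of_rk_eq {w w' : Perm ℕ} (h : ∀ p q, rk w p q = rk w' p q) : w = w' := by
  ext p
  have key : ∀ q, w p < q ↔ w' p < q := by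
    intro q
    have h1 := h (p + 1) q
    rw [rk_succ, rk_succ, h p q] at h1
    split_ifs at h1 <;> first | tauto | omega
  exact le_antisymm (Nat.lt_succ_iff.1 ((key _).2 (Nat.lt_succ_self _)))
    (Nat.lt_succ_iff.1 ((key _).1 (Nat.lt_succ_self _)))

lemma rk_succ_right (w : Perm ℕ) (p q : ℕ) :
    rk w p (q + 1) = rk w p q + if w⁻¹ q < p then 1 else 0 := by
  induction p with
  | zero => simp [rk_zero]
  | succ p ih =>
    rw [rk_succ, rk_succ, ih]
    have hq : w p = q ↔ w⁻¹ q = p := by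
      rw [Perm.inv_eq_iff_eq]; exact eq_comm
    split_ifs <;> omega

lemma mul_swap_apply_left (w : Perm ℕ) (m : ℕ) : (w * swap m (m + 1)) m = w (m + 1) := by simp

lemma mul_swap_apply_right (w : Perm ℕ) (m : ℕ) : (w * swap m (m + 1)) (m + 1) = w m := by simp

lemma mul_swap_apply_of_ne (w : Perm ℕ) {m i : ℕ} (h1 : i ≠ m) (h2 : i ≠ m + 1) :
    (w * swap m (m + 1)) i = w i := by
  rw [Perm.mul_apply, swap_apply_of_ne_of_ne h1 h2]

lemma rk_mul_swap_of_ne (w : Perm ℕ) {m p : ℕ} (q : ℕ) (hp : p ≠ m + 1) :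
    rk (w * swap m (m + 1)) p q = rk w p q := by
  have low : ∀ p ≤ m, rk (w * swap m (m + 1)) p q = rk w p q := fun p h =>
    rk_congr q fun i hi => mul_swap_apply_of_ne w (by omega) (by omega)
  rcases Nat.lt_or_ge m p with h | h
  · obtain ⟨t, rfl⟩ : ∃ t, p = m + 2 + t := ⟨p - (m + 2), by omega⟩
    clear hp h
    induction t with
    | zero =>
      simp only [add_zero]
      rw [rk_succ, rk_succ, rk_succ, rk_succ, low m le_rfl, mul_swap_apply_left,
        mul_swap_apply_right]
      omega
    | succ t ih =>
      rw [← add_assoc, rk_succ, rk_succ, ih, mul_swap_apply_of_ne w (by omega) (by omega)]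
  · exact low p h

lemma rk_mul_swap (w : Perm ℕ) (m q : ℕ) :
    rk (w * swap m (m + 1)) (m + 1) q = rk w m q + if w (m + 1) < q then 1 else 0 := by
  rw [rk_succ, mul_swap_apply_left, rk_mul_swap_of_ne w q (by omega)]

/-- Multiplication by the simple transposition `(m, m + 1)` in the `0`-Hecke monoid: the entries at
the positions `m` and `m + 1` are exchanged unless they already form an inversion. -/
def stick (w : Perm ℕ) (m : ℕ) : Perm ℕ := if w m < w (m + 1) then w * swap m (m + 1) else w

lemma rk_stick_of_ne (w : Perm ℕ) {m p : ℕ} (q : ℕ) (hp : p ≠ m + 1) :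
    rk (stick w m) p q = rk w p q := by
  unfold stick
  split_ifs
  · exact rk_mul_swap_of_ne w q hp
  · rfl

lemma rk_stick (w : Perm ℕ) (m q : ℕ) :
    rk (stick w m) (m + 1) q = max (rk w m q) (rk w (m + 2) q - 1) := by
  unfold stick
  have h2 : rk w (m + 2) q = _ := rk_succ w (m + 1) q
  have h1 := rk_succ w m q
  split_ifs with h
  · rw [rk_mul_swap]; split_ifs at * <;> omega
  · split_ifs at * <;> omega

lemma rk_ascent {w : Perm ℕ} {m : ℕ} (q : ℕ) (h : w m < w (m + 1)) :
    rk w (m + 1) q = min (rk w m q + 1) (rk w (m + 2) q) := by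
  have h2 : rk w (m + 2) q = _ := rk_succ w (m + 1) q
  have h1 := rk_succ w m q
  split_ifs at * <;> omega

lemma rk_succ_le_min (w : Perm ℕ) (m q : ℕ) :
    rk w (m + 1) q ≤ min (rk w m q + 1) (rk w (m + 2) q) := by
  have h2 : rk w (m + 2) q = _ := rk_succ w (m + 1) q
  have h1 := rk_succ w m q
  split_ifs at * <;> omega

/-- The transposition `(m, m + 1)` preserves the order of every pair of positions other than
`m < m + 1`. -/
lemma swap_succ_lt {m i j : ℕ} (hij : i < j) (hmm : ¬ (i = m ∧ j = m + 1)) :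
    swap m (m + 1) i < swap m (m + 1) j := by
  have hsm : swap m (m + 1) m = m + 1 := swap_apply_left _ _
  have hsm' : swap m (m + 1) (m + 1) = m := swap_apply_right _ _
  have hne : ∀ i, i ≠ m → i ≠ m + 1 → swap m (m + 1) i = i := fun i => swap_apply_of_ne_of_ne
  by_cases i1 : i = m <;> by_cases i2 : i = m + 1 <;> by_cases j1 : j = m <;>
    by_cases j2 : j = m + 1 <;>
    simp_all <;> omega

/-- The pairs of positions below `n` that are inversions of `w`. -/
def inversions (n : ℕ) (w : Perm ℕ) : Finset (ℕ × ℕ) :=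
  (range n ×ˢ range n).filter fun x => x.1 < x.2 ∧ w x.2 < w x.1

lemma mem_inversions {n : ℕ} {w : Perm ℕ} {i j : ℕ} :
    (i, j) ∈ inversions n w ↔ (i < n ∧ j < n) ∧ i < j ∧ w j < w i := by
  simp [inversions]

lemma inversions_one (n : ℕ) : inversions n 1 = ∅ := by
  apply filter_eq_empty_iff.2
  rintro ⟨i, j⟩ -
  simp only [Perm.one_apply]
  omega

lemma card_inversions_mul_swap {n m : ℕ} (hm : m + 1 < n) {w : Perm ℕ} (h : w m < w (m + 1)) :
    (inversions n (w * swap m (m + 1))).card = (inversions n w).card + 1 := by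
  set s := swap m (m + 1) with hs
  have hsm : s m = m + 1 := swap_apply_left _ _
  have hsm' : s (m + 1) = m := swap_apply_right _ _
  have hne : ∀ i, i ≠ m → i ≠ m + 1 → s i = i := fun i => swap_apply_of_ne_of_ne
  have hss : ∀ i, s (s i) = i := fun i => swap_apply_self ..
  have hord : ∀ i j, i < j → ¬ (i = m ∧ j = m + 1) → s i < s j := fun i j => swap_succ_lt
  have hlt : ∀ i, i < n → s i < n := by
    intro i hi
    by_cases i1 : i = m
    · subst i1; omega
    · by_cases i2 : i = m + 1
      · subst i2; omega
      · rwa [hne i i1 i2]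
  have heq : inversions n (w * s) =
      insert (m, m + 1) ((inversions n w).image fun x => (s x.1, s x.2)) := by
    ext ⟨i, j⟩
    simp only [mem_inversions, mem_insert, mem_image, Prod.mk.injEq, Perm.mul_apply, Prod.exists]
    constructor
    · rintro ⟨⟨hi, hj⟩, hij, hw⟩
      by_cases hmm : i = m ∧ j = m + 1
      · exact Or.inl hmm
      · exact Or.inr ⟨s i, s j, ⟨⟨hlt i hi, hlt j hj⟩, hord i j hij hmm, hw⟩, hss i, hss j⟩
    · rintro (⟨rfl, rfl⟩ | ⟨i', j', ⟨⟨hi, hj⟩, hij, hw⟩, rfl, rfl⟩)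
      · exact ⟨⟨by omega, hm⟩, by omega, by rw [hsm, hsm']; exact h⟩
      · have hmm : ¬ (i' = m ∧ j' = m + 1) := by
          rintro ⟨rfl, rfl⟩; omega
        exact ⟨⟨hlt _ hi, hlt _ hj⟩, hord _ _ hij hmm, by rwa [hss, hss]⟩
  rw [heq, card_insert_of_notMem, card_image_of_injective]
  · rintro ⟨a, b⟩ ⟨c, d⟩ hx
    simpa using hx
  · simp only [mem_inversions, mem_image, Prod.mk.injEq, Prod.exists, not_exists]
    rintro i j ⟨⟨-, hij, hw⟩, h1, h2⟩
    have h3 : i = m + 1 := by rw [← hss i, h1, hsm]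
    have h4 : j = m := by rw [← hss j, h2, hsm']
    omega

/-- If the ranks of the identity are bounded by those of `σ`, then `σ` is the identity. -/
lemma eq_one_of_rk_le {σ : Perm ℕ} (h : ∀ p q, rk 1 p q ≤ rk σ p q) : σ = 1 := by
  have hle : ∀ p, σ p ≤ p := by
    intro p
    have hb : ∀ r, rk σ r (p + 1) ≤ r := by
      intro r
      induction r with
      | zero => simp [rk_zero]
      | succ r ih => rw [rk_succ]; split_ifs <;> omega
    have h1 := h (p + 1) (p + 1)
    rw [rk_one, rk_succ] at h1
    have h2 := hb p
    split_ifs at h1 <;> omega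
  have : ∀ p, σ p = p := by
    intro p
    induction p using Nat.strong_induction_on with
    | _ p ih =>
      by_contra hne
      have hlt : σ p < p := lt_of_le_of_ne (hle p) hne
      exact hne (σ.injective (ih _ hlt))
  ext p
  exact this p

/-! ### The diagram of a permutation and its essential set -/

/-- The diagram of a permutation of `ℕ`. -/
def InDiagram (w : Perm ℕ) (p q : ℕ) : Prop := q < w p ∧ p < w⁻¹ q

/-- The box `(p, q)` is a south-east corner of the diagram of `w`. -/
def IsEssential (w : Perm ℕ) (p q : ℕ) : Prop :=
  InDiagram w p q ∧ ¬ InDiagram w (p + 1) q ∧ ¬ InDiagram w p (q + 1)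

lemma inDiagram_iff_rk (w : Perm ℕ) (p q : ℕ) :
    InDiagram w p q ↔ rk w (p + 1) (q + 1) = rk w p q := by
  have h1 := rk_succ w p (q + 1)
  have h2 := rk_succ_right w p q
  have hq : w p = q ↔ w⁻¹ q = p := by
    rw [Perm.inv_eq_iff_eq]; exact eq_comm
  unfold InDiagram
  split_ifs at h1 h2 <;> omega

lemma isEssential_iff_rk (w : Perm ℕ) (p q : ℕ) :
    IsEssential w p q ↔ rk w (p + 1) (q + 1) = rk w p q ∧
      rk w (p + 2) (q + 1) = rk w (p + 1) (q + 1) + 1 ∧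
      rk w (p + 1) (q + 2) = rk w (p + 1) (q + 1) + 1 := by
  rw [← inDiagram_iff_rk]
  have e1 := rk_succ w (p + 1) (q + 1)
  have e2 := rk_succ_right w (p + 1) (q + 1)
  have hq : w (p + 1) = q ↔ w⁻¹ q = p + 1 := by
    rw [Perm.inv_eq_iff_eq]; exact eq_comm
  have hq' : w p = q + 1 ↔ w⁻¹ (q + 1) = p := by
    rw [Perm.inv_eq_iff_eq]; exact eq_comm
  unfold IsEssential InDiagram
  rw [show p + 1 + 1 = p + 2 from rfl] at e1
  rw [show q + 1 + 1 = q + 2 from rfl] at e2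
  split_ifs at e1 e2 <;> omega

/-- The diagram of a permutation of `{0, …, n-1}` lies in `{0, …, n-1}²`. -/
lemma InDiagram.lt {w : Perm ℕ} {n p q : ℕ} (hw : ∀ i, n ≤ i → w i = i) (h : InDiagram w p q) :
    p + 1 < n ∧ q + 1 < n := by
  obtain ⟨h1, h2⟩ := h
  have hwi : ∀ i, n ≤ i → w⁻¹ i = i := fun i hi => by
    rw [Perm.inv_eq_iff_eq, hw i hi]
  have hlt : ∀ i, i < n → w i < n := fun i hi => by
    by_contra hc
    have : w (w i) = w i := hw _ (by omega)
    have := w.injective this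
    omega
  have hlti : ∀ i, i < n → w⁻¹ i < n := fun i hi => by
    by_contra hc
    have h3 : w (w⁻¹ i) = w⁻¹ i := hw _ (by omega)
    rw [show w (w⁻¹ i) = i from Equiv.apply_symm_apply w i] at h3
    omega
  rcases Nat.lt_or_ge p n with hp | hp <;> rcases Nat.lt_or_ge q n with hq | hq
  · have := hlt p hp; have := hlti q hq; omega
  · have := hwi q hq; have := hlt p hp; omega
  · have := hw p hp; have := hlti q hq; omega
  · have := hw p hp; have := hwi q hq; omega

/-- The ranks of a permutation on its essential set bound all its ranks: from a box where the bound
fails, one can walk north-west into the diagram and then south-east to a corner of the diagram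
without losing the failure. -/
theorem rk_le_of_essential {n : ℕ} {w σ : Perm ℕ} (hσ : ∀ i, n ≤ i → σ i = i)
    (h : ∀ p q, IsEssential σ p q → rk w (p + 1) (q + 1) ≤ rk σ (p + 1) (q + 1)) (p q : ℕ) :
    rk w p q ≤ rk σ p q := by
  have diag : ∀ d p q, 2 * n ≤ p + q + d → InDiagram σ p q →
      rk w (p + 1) (q + 1) ≤ rk σ (p + 1) (q + 1) := by
    intro d
    induction d with
    | zero =>
      intro p q hd hpq
      have := hpq.lt hσ
      omega
    | succ d ih =>
      intro p q hd hpq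
      by_cases h1 : InDiagram σ (p + 1) q
      · have h2 := ih (p + 1) q (by omega) h1
        have h3 := rk_succ w (p + 1) (q + 1)
        have h4 := rk_succ σ (p + 1) (q + 1)
        rw [if_neg (by have := h1.1; omega)] at h4
        omega
      by_cases h2 : InDiagram σ p (q + 1)
      · have h5 := ih p (q + 1) (by omega) h2
        have h3 := rk_succ_right w (p + 1) (q + 1)
        have h4 := rk_succ_right σ (p + 1) (q + 1)
        rw [if_neg (by have := h2.2; omega)] at h4
        omega
      exact h p q ⟨hpq, h1, h2⟩
  have all : ∀ d p q, p + q ≤ d → rk w p q ≤ rk σ p q := by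
    intro d
    induction d with
    | zero =>
      intro p q hd
      obtain rfl : p = 0 := by omega
      simp [rk_zero]
    | succ d ih =>
      intro p q hd
      rcases p with _ | p
      · simp [rk_zero]
      rcases q with _ | q
      · simp [rk]
      by_cases hD : InDiagram σ p q
      · exact diag (2 * n) p q (by omega) hD
      have hq : σ p = q ↔ σ⁻¹ q = p := by
        rw [Perm.inv_eq_iff_eq]; exact eq_comm
      by_cases hp : σ p < q + 1
      · have h1 := ih p (q + 1) (by omega)
        have h3 := rk_succ w p (q + 1)
        have h4 := rk_succ σ p (q + 1)
        split_ifs at h3 h4 <;> omega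
      · have h1 := ih (p + 1) q (by omega)
        have h3 := rk_succ_right w (p + 1) q
        have h4 := rk_succ_right σ (p + 1) q
        unfold InDiagram at hD
        split_ifs at h3 h4 <;> omega
  exact all _ p q le_rfl

section

/-! ### Longest north-east chains in the complement of a set of boxes -/

/-- The largest length of a sequence of boxes outside `D`, each strictly north and strictly east of
the preceding one, in the rows `< x` and the columns `≥ j` and `< q`. The southernmost row is
scanned for the first, that is, the south-western box of the sequence. -/
def longest (D : Finset Box) (q : ℕ) : ℕ → ℕ → ℕ
  | 0, _ => 0
  | x + 1, j => max (longest D q x j)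
      (((Ico j q).filter fun v => (x, v) ∉ D).sup fun v => longest D q x (v + 1) + 1)

variable {D : Finset Box} {q x x' j j' : ℕ}

lemma longest_succ_le_iff {l : ℕ} :
    longest D q (x + 1) j ≤ l ↔ longest D q x j ≤ l ∧
      ∀ v, j ≤ v → v < q → (x, v) ∉ D → longest D q x (v + 1) + 1 ≤ l := by
  simp only [longest, max_le_iff, Finset.sup_le_iff, mem_filter, mem_Ico, and_imp]

lemma longest_le_succ : longest D q x j ≤ longest D q (x + 1) j :=
  (longest_succ_le_iff.1 le_rfl).1

lemma longest_step (hj : j < q) (h : (x, j) ∉ D) :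
    longest D q x (j + 1) + 1 ≤ longest D q (x + 1) j :=
  (longest_succ_le_iff.1 le_rfl).2 j le_rfl hj h

lemma longest_mono (h : x ≤ x') (hj : j' ≤ j) : longest D q x j ≤ longest D q x' j' := by
  have h1 : longest D q x j ≤ longest D q x' j :=
    monotone_nat_of_le_succ (f := fun x => longest D q x j) (fun _ => longest_le_succ) h
  refine h1.trans ?_
  clear h1 h
  induction x' generalizing j j' with
  | zero => exact le_rfl
  | succ x ih =>
    refine longest_succ_le_iff.2 ⟨(ih hj).trans longest_le_succ, fun v hv hvq hD => ?_⟩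
    exact (longest_succ_le_iff.1 le_rfl).2 v (hj.trans hv) hvq hD

lemma longest_of_le (h : q ≤ j) : longest D q x j = 0 := by
  induction x generalizing j with
  | zero => rfl
  | succ x ih =>
    refine Nat.le_zero.1 (longest_succ_le_iff.2 ⟨(ih h).le, fun v hv hvq _ => ?_⟩)
    omega

lemma longest_le_succ_right : longest D q x j ≤ longest D q x (j + 1) + 1 := by
  induction x with
  | zero => exact Nat.zero_le _
  | succ x ih =>
    have h := longest_le_succ (D := D) (q := q) (x := x) (j := j + 1)
    refine longest_succ_le_iff.2 ⟨by omega, fun v hv _ _ => ?_⟩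
    have := longest_mono (D := D) (q := q) (le_refl x) (Nat.succ_le_succ hv)
    simp only [Nat.succ_eq_add_one] at this
    omega

lemma longest_succ_le : longest D q (x + 1) j ≤ longest D q x (j + 1) + 1 :=
  longest_succ_le_iff.2 ⟨longest_le_succ_right, fun _ hv _ _ =>
    Nat.succ_le_succ (longest_mono le_rfl (Nat.succ_le_succ hv))⟩

lemma longest_add_le (t : ℕ) : longest D q (x + t) j ≤ longest D q x (j + t) + t := by
  induction t generalizing j with
  | zero => exact le_rfl
  | succ t ih =>
    have h1 := longest_succ_le (D := D) (q := q) (x := x + t) (j := j)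
    have h2 := ih (j := j + 1)
    rw [show j + 1 + t = j + (t + 1) by omega] at h2
    rw [← add_assoc]
    omega

lemma longest_le_left : longest D q x j ≤ x := by
  have h := longest_add_le (D := D) (q := q) (x := 0) (j := j) x
  simpa [longest] using h

lemma longest_add_le_of_le (h : j ≤ q) : longest D q x j + j ≤ q := by
  obtain ⟨t, rfl⟩ := Nat.exists_eq_add_of_le h
  have h1 := longest_add_le (D := D) (q := j + t) (x := x) (j := j) t
  rw [longest_of_le le_rfl] at h1
  have := longest_mono (D := D) (q := j + t) (Nat.le_add_right x t) (le_refl j)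
  omega

/-- An antidiagonal of boxes outside `D` contributes its length. -/
lemma add_longest_le (t : ℕ) (hq : j + t ≤ q) (h : ∀ s < t, (x + s, j + (t - 1 - s)) ∉ D) :
    t + longest D q x (j + t) ≤ longest D q (x + t) j := by
  induction t generalizing j with
  | zero => simp
  | succ t ih =>
    have h1 := ih (j := j + 1) (by omega) (fun s hs => by
      have := h s (by omega)
      rwa [show j + 1 + (t - 1 - s) = j + (t + 1 - 1 - s) by omega])
    have h2 := longest_step (D := D) (q := q) (x := x + t) (j := j) (by omega) (by
      have := h t (by omega)
      simpa using this)
    rw [show j + (t + 1) = j + 1 + t by omega]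
    rw [← add_assoc x]
    omega

/-- A single box outside `D` as south-west end of a chain. -/
lemma longest_cons {u v : ℕ} (hu : u < x) (hv : j ≤ v) (hq : v < q) (h : (u, v) ∉ D) :
    longest D q u (v + 1) + 1 ≤ longest D q x j :=
  (longest_step hq h).trans (longest_mono hu hv)

lemma exists_of_lt_longest {l : ℕ} (h : l < longest D q x j) :
    ∃ u v, u < x ∧ j ≤ v ∧ v < q ∧ (u, v) ∉ D ∧ l ≤ longest D q u (v + 1) := by
  induction x with
  | zero => simp [longest] at h
  | succ x ih =>
    rw [← not_le, longest_succ_le_iff, not_and_or] at h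
    rcases h with h | h
    · obtain ⟨u, v, h1, h2⟩ := ih (not_le.1 h)
      exact ⟨u, v, by omega, h2⟩
    · push Not at h
      obtain ⟨v, h1, h2, h3, h4⟩ := h
      exact ⟨x, v, by omega, h1, h2, h3, by omega⟩

/-- Among the boxes of a chain of length `l + a`, the `l` south-western ones leave room for the
other `a` boxes: they lie below the first `a` rows and to the left of the last `a` columns. -/
lemma exists_chain_of_le_longest {l a : ℕ} (h : l + a ≤ longest D q x j) :
    ∃ s : Fin l → Box, (∀ t u : Fin l, t < u → (s u).1 < (s t).1 ∧ (s t).2 < (s u).2) ∧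
      ∀ t, s t ∉ D ∧ a ≤ (s t).1 ∧ (s t).1 < x ∧ j ≤ (s t).2 ∧ (s t).2 + a < q := by
  induction l generalizing x j with
  | zero => exact ⟨Fin.elim0, fun t => t.elim0, fun t => t.elim0⟩
  | succ l ih =>
    obtain ⟨u, v, hu, hv, hvq, hD, hl⟩ := exists_of_lt_longest (D := D) (q := q) (x := x) (j := j)
      (l := l + a) (by omega)
    obtain ⟨s, hs, hs'⟩ := ih hl
    have h1 := longest_le_left (D := D) (q := q) (x := u) (j := v + 1)
    have h2 := longest_add_le_of_le (D := D) (q := q) (x := u) (j := v + 1) hvq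
    refine ⟨Fin.cons (u, v) s, fun t t' => ?_, fun t => ?_⟩
    · refine Fin.cases ?_ (fun t => ?_) t <;> refine Fin.cases ?_ (fun t' => ?_) t'
      · simp
      · intro _
        have := hs' t'
        simp only [Fin.cons_zero, Fin.cons_succ]
        omega
      · intro h; exact absurd h (by simp)
      · intro h
        simpa using hs t t' (by simpa using h)
    · refine Fin.cases ?_ (fun t => ?_) t
      · simp only [Fin.cons_zero]
        exact ⟨hD, by omega, hu, hv, by omega⟩
      · have := hs' t
        simp only [Fin.cons_succ]
        exact ⟨this.1, by omega, by omega, by omega, by omega⟩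

lemma add_longest_le_of_chain {l a d : ℕ} (s : Fin l → Box)
    (hs : ∀ t u : Fin l, t < u → (s u).1 < (s t).1 ∧ (s t).2 < (s u).2)
    (hs' : ∀ t, s t ∉ D ∧ a ≤ (s t).1 ∧ (s t).1 < x ∧ j ≤ (s t).2 ∧ (s t).2 ≤ d)
    (hax : a ≤ x) (hjd : j ≤ d + 1) (hq : d < q) :
    l + longest D q a (d + 1) ≤ longest D q x j := by
  induction l generalizing x j with
  | zero => simpa using longest_mono hax hjd
  | succ l ih =>
    have h0 := hs' 0
    have h1 := ih (x := (s 0).1) (j := (s 0).2 + 1) (fun t => s t.succ)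
      (fun t u htu => hs _ _ (by simpa using htu))
      (fun t => by
        have h2 := hs' t.succ
        have h3 := hs 0 t.succ (Fin.succ_pos t)
        exact ⟨h2.1, h2.2.1, h3.1, h3.2, h2.2.2.2.2⟩) h0.2.1 (by omega)
    have h4 := longest_cons (D := D) (q := q) h0.2.2.1 h0.2.2.2.1 (by omega) h0.1
    omega

/-- The rank function of a pipe dream on the lattice points, written in terms of chains. -/
def chainRank (D : Finset Box) (q x j : ℕ) : ℕ := longest D q x j + min j q

lemma chainRank_zero : chainRank D q 0 j = min j q := by simp [chainRank, longest]

lemma chainRank_of_notMem (h : (x, j) ∉ D) :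
    chainRank D q (x + 1) j = chainRank D q x (j + 1) := by
  unfold chainRank
  rcases Nat.lt_or_ge j q with hj | hj
  · have h1 := longest_step hj h
    have h2 := longest_succ_le (D := D) (q := q) (x := x) (j := j)
    omega
  · rw [longest_of_le hj, longest_of_le (by omega)]
    omega

lemma chainRank_of_mem (h : (x, j) ∈ D) :
    chainRank D q (x + 1) j = max (chainRank D q x j) (chainRank D q (x + 1) (j + 1) - 1) := by
  unfold chainRank
  rcases Nat.lt_or_ge j q with hj | hj
  · have h1 := longest_le_succ (D := D) (q := q) (x := x) (j := j)
    have h2 := longest_mono (D := D) (q := q) (le_refl (x + 1)) (Nat.le_succ j)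
    have h3 : longest D q (x + 1) j ≤ max (longest D q x j) (longest D q (x + 1) (j + 1)) := by
      refine longest_succ_le_iff.2 ⟨le_max_left _ _, fun v hv hvq hvD => ?_⟩
      have hne : v ≠ j := by rintro rfl; exact hvD h
      exact le_max_of_le_right ((longest_succ_le_iff.1 le_rfl).2 v (by omega) hvq hvD)
    simp only [Nat.succ_eq_add_one] at h2
    omega
  · rw [longest_of_le hj, longest_of_le hj, longest_of_le (by omega)]
    omega

end

section

/-! ### Reading a pipe dream as a word -/

/-- The box read at time `t` when the rows of the `n × n` square are read from top to bottom, and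
every row from right to left. -/
def cellAt (n t : ℕ) : Box := (t / n, n - 1 - t % n)

/-- The position of the simple transposition that belongs to the box read at time `t`. -/
def letter (n t : ℕ) : ℕ := (cellAt n t).1 + (cellAt n t).2

/-- The order of the pipes along the boundary of the region read before time `t`. -/
def plain (D : Finset Box) (n : ℕ) : ℕ → Perm ℕ
  | 0 => 1
  | t + 1 =>
    if cellAt n t ∈ D then plain D n t * swap (letter n t) (letter n t + 1) else plain D n t

/-- As `plain`, but two pipes that have crossed before do not cross again: this is the Demazure
product of the word that has been read. -/
def sticky (D : Finset Box) (n : ℕ) : ℕ → Perm ℕ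
  | 0 => 1
  | t + 1 => if cellAt n t ∈ D then stick (sticky D n t) (letter n t) else sticky D n t

/-- In the sequence `w` of permutations, every box of `D` creates an inversion. -/
def Ascending (D : Finset Box) (n : ℕ) (w : ℕ → Perm ℕ) : Prop :=
  ∀ t, cellAt n t ∈ D → w t (letter n t) < w t (letter n t + 1)

/-- The number of boxes of `D` read before time `t`. -/
def countCells (D : Finset Box) (n t : ℕ) : ℕ := ((range t).filter fun s => cellAt n s ∈ D).card

variable {D : Finset Box} {n : ℕ}

lemma cellAt_eq {i j : ℕ} (hj : j < n) : cellAt n (i * n + (n - 1 - j)) = (i, j) := by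
  have hn : 0 < n := by omega
  unfold cellAt
  rw [add_comm, Nat.add_mul_div_right _ _ hn, Nat.add_mul_mod_self_right,
    Nat.mod_eq_of_lt (by omega), Nat.div_eq_of_lt (by omega)]
  ext <;> simp only <;> omega

lemma letter_eq {t i j : ℕ} (h : cellAt n t = (i, j)) : letter n t = i + j := by
  simp [letter, h]

lemma cellAt_injective (hn : 0 < n) : Function.Injective (cellAt n) := by
  intro s t h
  simp only [cellAt, Prod.mk.injEq] at h
  have h1 := Nat.mod_lt s hn
  have h2 := Nat.mod_lt t hn
  have h3 : s % n = t % n := by omega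
  rw [← Nat.div_add_mod s n, ← Nat.div_add_mod t n, h.1, h3]

lemma cellAt_injOn (hD : ∀ x ∈ D, x ∈ staircase n) {s t : ℕ} (ht : cellAt n t ∈ D)
    (h : cellAt n s = cellAt n t) : s = t := by
  have : (cellAt n t).1 + (cellAt n t).2 + 1 < n := hD _ ht
  exact cellAt_injective (by omega) h

lemma exists_cellAt (hD : ∀ x ∈ D, x ∈ staircase n) {x : Box} (hx : x ∈ D) :
    ∃ t < n * n, cellAt n t = x := by
  have h : x.1 + x.2 + 1 < n := hD x hx
  refine ⟨x.1 * n + (n - 1 - x.2), ?_, cellAt_eq (by omega)⟩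
  calc x.1 * n + (n - 1 - x.2) < x.1 * n + n := by omega
    _ = (x.1 + 1) * n := by ring
    _ ≤ n * n := Nat.mul_le_mul_right n (by omega)

lemma letter_lt (hD : ∀ x ∈ D, x ∈ staircase n) {t : ℕ} (ht : cellAt n t ∈ D) :
    letter n t + 1 < n := hD _ ht

lemma notMem_of_le (hD : ∀ x ∈ D, x ∈ staircase n) {i j : ℕ} (hj : n ≤ j) : (i, j) ∉ D := by
  intro h
  have : i + j + 1 < n := hD _ h
  omega

lemma countCells_eq_card (hD : ∀ x ∈ D, x ∈ staircase n) : countCells D n (n * n) = D.card := by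
  unfold countCells
  rw [← card_image_of_injOn (f := cellAt n)]
  · congr 1
    ext x
    simp only [mem_image, mem_filter, mem_range]
    constructor
    · rintro ⟨t, ⟨-, h⟩, rfl⟩
      exact h
    · intro hx
      obtain ⟨t, ht, rfl⟩ := exists_cellAt hD hx
      exact ⟨t, ⟨ht, hx⟩, rfl⟩
  · intro s _ t ht h
    simp only [coe_filter, Set.mem_ofPred_eq] at ht
    exact cellAt_injOn hD ht.2 h

lemma countCells_succ (t : ℕ) :
    countCells D n (t + 1) = countCells D n t + if cellAt n t ∈ D then 1 else 0 := by
  unfold countCells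
  rw [range_add_one, filter_insert]
  split_ifs
  · rw [card_insert_of_notMem (by simp)]
  · rfl

/-- Induction along the reading order: `P t i j` concerns the time `t` at which, in row `i`, the
boxes of the columns `j, …, n - 1` have been read. -/
lemma reading_induction {P : ℕ → ℕ → ℕ → Prop} (zero : P 0 0 n)
    (step : ∀ t i j, cellAt n t = (i, j) → P t i (j + 1) → P (t + 1) i j)
    (wrap : ∀ t i, P t i 0 → P t (i + 1) n) (i j : ℕ) (hj : j ≤ n) :
    P (i * n + (n - j)) i j := by
  have row : ∀ i, P (i * n) i n → ∀ y ≤ n, P (i * n + y) i (n - y) := by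
    intro i h y
    induction y with
    | zero => intro _; simpa using h
    | succ y ih =>
      intro hy
      refine step _ _ _ ?_ ?_
      · have := cellAt_eq (n := n) (i := i) (j := n - (y + 1)) (by omega)
        rwa [show n - 1 - (n - (y + 1)) = y by omega] at this
      · rw [show n - (y + 1) + 1 = n - y by omega]
        exact ih (by omega)
  have first : ∀ i, P (i * n) i n := by
    intro i
    induction i with
    | zero => simpa using zero
    | succ i ih =>
      have := row i ih n le_rfl
      rw [Nat.sub_self] at this
      rw [show (i + 1) * n = i * n + n by ring]
      exact wrap _ _ this
  have := row i (first i) (n - j) (by omega)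
  rwa [show n - (n - j) = j by omega] at this

lemma sticky_apply_of_le (hD : ∀ x ∈ D, x ∈ staircase n) (t : ℕ) {m : ℕ} (hm : n ≤ m) :
    sticky D n t m = m := by
  induction t with
  | zero => rfl
  | succ t ih =>
    rw [sticky]
    split_ifs with h
    · have := letter_lt hD h
      rw [stick]
      split_ifs
      · rw [mul_swap_apply_of_ne _ (by omega) (by omega), ih]
      · exact ih
    · exact ih

lemma Ascending.plain_eq_sticky (h : Ascending D n (plain D n)) (t : ℕ) :
    plain D n t = sticky D n t := by
  induction t with
  | zero => rfl
  | succ t ih =>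
    rw [sticky, plain, ← ih]
    split_ifs with hc
    · rw [stick, if_pos (h t hc)]
    · rfl

lemma Ascending.sticky_eq_plain (h : Ascending D n (sticky D n)) (t : ℕ) :
    sticky D n t = plain D n t := by
  induction t with
  | zero => rfl
  | succ t ih =>
    rw [sticky, plain, ← ih]
    split_ifs with hc
    · rw [stick, if_pos (h t hc)]
    · rfl

lemma Ascending.card_inversions (hD : ∀ x ∈ D, x ∈ staircase n) (h : Ascending D n (plain D n))
    (t : ℕ) : (inversions n (plain D n t)).card = countCells D n t := by
  induction t with
  | zero => simp [plain, inversions_one, countCells]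
  | succ t ih =>
    rw [plain, countCells_succ]
    split_ifs with hc
    · rw [card_inversions_mul_swap (letter_lt hD hc) (h t hc), ih]
    · rw [ih, add_zero]

/-- If the ranks of the Demazure product are bounded by those of `σ`, then the word is at least as
long as `σ`, and equality holds only for reduced words of `σ`. The last letter `m` of the word is
removed together with, if `m` is a descent of `σ`, the corresponding inversion of `σ`. -/
theorem card_inversions_le (hD : ∀ x ∈ D, x ∈ staircase n) (t : ℕ) (σ : Perm ℕ)
    (h : ∀ p q, rk (sticky D n t) p q ≤ rk σ p q) :
    (inversions n σ).card ≤ countCells D n t ∧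
      ((inversions n σ).card = countCells D n t → sticky D n t = σ ∧
        ∀ s < t, cellAt n s ∈ D →
          sticky D n s (letter n s) < sticky D n s (letter n s + 1)) := by
  induction t generalizing σ with
  | zero =>
    obtain rfl := eq_one_of_rk_le h
    simp [inversions_one, sticky]
  | succ t ih =>
    rw [countCells_succ]
    by_cases hc : cellAt n t ∈ D
    · rw [if_pos hc]
      set m := letter n t with hm
      set w := sticky D n t with hw
      have hsucc : sticky D n (t + 1) = stick w m := by rw [sticky, if_pos hc]
      rw [hsucc] at h ⊢
      have hother : ∀ p q, p ≠ m + 1 → rk w p q ≤ rk σ p q := fun p q hp => by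
        rw [← rk_stick_of_ne w q hp]; exact h p q
      have hmid : ∀ q, rk w (m + 1) q ≤ min (rk σ m q + 1) (rk σ (m + 2) q) := fun q => by
        have h1 := rk_succ_le_min w m q
        have h2 := hother m q (by omega)
        have h3 := hother (m + 2) q (by omega)
        omega
      rcases lt_or_ge (σ m) (σ (m + 1)) with hasc | hdesc
      · have hle : ∀ p q, rk w p q ≤ rk σ p q := fun p q => by
          by_cases hp : p = m + 1
          · subst hp
            rw [rk_ascent q hasc]
            exact hmid q
          · exact hother p q hp
        have := (ih σ hle).1
        exact ⟨by omega, fun heq => by omega⟩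
      · have hdesc : σ (m + 1) < σ m :=
          lt_of_le_of_ne hdesc fun he => by have := σ.injective he; omega
        set τ := σ * swap m (m + 1) with hτ
        have hστ : σ = τ * swap m (m + 1) := by
          rw [hτ, mul_assoc, swap_mul_self, mul_one]
        have hasc : τ m < τ (m + 1) := by
          rw [hτ, mul_swap_apply_left, mul_swap_apply_right]; exact hdesc
        have hle : ∀ p q, rk w p q ≤ rk τ p q := fun p q => by
          by_cases hp : p = m + 1
          · subst hp
            rw [rk_ascent q hasc, hτ, rk_mul_swap_of_ne σ q (by omega),
              rk_mul_swap_of_ne σ q (by omega)]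
            exact hmid q
          · rw [hτ, rk_mul_swap_of_ne σ q hp]
            exact hother p q hp
        have hcard : (inversions n σ).card = (inversions n τ).card + 1 := by
          conv_lhs => rw [hστ]
          exact card_inversions_mul_swap (letter_lt hD hc) hasc
        obtain ⟨h1, h2⟩ := ih τ hle
        refine ⟨by omega, fun heq => ?_⟩
        obtain ⟨h3, h4⟩ := h2 (by omega)
        refine ⟨?_, fun s hs hsD => ?_⟩
        · rw [h3, stick, if_pos hasc, ← hστ]
        · rcases Nat.lt_succ_iff_lt_or_eq.1 hs with hs | rfl
          · exact h4 s hs hsD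
          · rw [← hw, h3]; exact hasc
    · rw [if_neg hc]
      have hsucc : sticky D n (t + 1) = sticky D n t := by rw [sticky, if_neg hc]
      rw [hsucc] at h ⊢
      obtain ⟨h1, h2⟩ := ih σ h
      refine ⟨h1, fun heq => ⟨(h2 heq).1, fun s hs hsD => ?_⟩⟩
      rcases Nat.lt_succ_iff_lt_or_eq.1 hs with hs | rfl
      · exact (h2 heq).2 s hs hsD
      · exact absurd hsD hc

/-- The ranks of the Demazure product along the boundary of the region that has been read. -/
lemma rk_sticky_reading (hD : ∀ x ∈ D, x ∈ staircase n) (q i j : ℕ) (hj : j ≤ n) :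
    (∀ m ≤ i, rk (sticky D n (i * n + (n - j))) m q = chainRank D q m 0) ∧
    (∀ m ≤ j, rk (sticky D n (i * n + (n - j))) (i + m) q = chainRank D q i m) ∧
    (∀ m, j ≤ m → rk (sticky D n (i * n + (n - j))) (i + m + 1) q = chainRank D q (i + 1) m) := by
  refine reading_induction (n := n) (P := fun t i j =>
    (∀ m ≤ i, rk (sticky D n t) m q = chainRank D q m 0) ∧
    (∀ m ≤ j, rk (sticky D n t) (i + m) q = chainRank D q i m) ∧
    (∀ m, j ≤ m → rk (sticky D n t) (i + m + 1) q = chainRank D q (i + 1) m)) ?_ ?_ ?_ i j hj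
  · refine ⟨fun m hm => ?_, fun m _ => ?_, fun m hm => ?_⟩
    · obtain rfl : m = 0 := by omega
      simp [rk_zero, chainRank_zero]
    · rw [sticky, rk_one, chainRank_zero, zero_add]
    · rw [sticky, rk_one, chainRank_of_notMem (notMem_of_le hD hm), chainRank_zero, zero_add]
  · rintro t i j ht ⟨ha, hb, hc⟩
    have hl := letter_eq ht
    have hother : ∀ p, p ≠ i + j + 1 → rk (sticky D n (t + 1)) p q = rk (sticky D n t) p q := by
      intro p hp
      rw [sticky]
      split_ifs
      · exact rk_stick_of_ne _ _ (by omega)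
      · rfl
    refine ⟨fun m hm => ?_, fun m hm => ?_, fun m hm => ?_⟩
    · rw [hother _ (by omega), ha m hm]
    · rw [hother _ (by omega), hb m (by omega)]
    · rcases Nat.eq_or_lt_of_le hm with rfl | hm
      · rw [sticky, ht]
        split_ifs with hD'
        · rw [hl, rk_stick, chainRank_of_mem hD', hb j (by omega), ← hc (j + 1) le_rfl]
          rfl
        · rw [chainRank_of_notMem hD', ← hb (j + 1) le_rfl]
          rfl
      · rw [hother _ (by omega), hc m hm]
  · rintro t i ⟨ha, hb, hc⟩
    refine ⟨fun m hm => ?_, fun m _ => ?_, fun m hm => ?_⟩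
    · rcases Nat.lt_succ_iff_lt_or_eq.1 (Nat.lt_succ_of_le hm) with hm | rfl
      · exact ha m (by omega)
      · exact hc 0 le_rfl
    · rw [← hc m (Nat.zero_le _)]
      congr 1; omega
    · rw [chainRank_of_notMem (notMem_of_le hD hm), ← hc (m + 1) (Nat.zero_le _)]
      congr 1; omega

/-- The ranks of the Demazure product of `D` are the lengths of the longest north-east chains in the
complement of `D`. -/
theorem rk_sticky (hD : ∀ x ∈ D, x ∈ staircase n) {p : ℕ} (hp : p ≤ n) (q : ℕ) :
    rk (sticky D n (n * n)) p q = longest D q p 0 := by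
  have := (rk_sticky_reading hD q n n le_rfl).1 p hp
  simpa [chainRank] using this

/-- A box of `D` creates an inversion if, for some `q`, the longest chains ending in the columns
`< q` do not become longer when its row and column are added. -/
lemma sticky_ascent (hD : ∀ x ∈ D, x ∈ staircase n) {i j t : ℕ} (ht : cellAt n t = (i, j))
    (hij : (i, j) ∈ D) {q : ℕ} (hjq : j < q)
    (h : longest D q (i + 1) j ≤ longest D q i (j + 1)) :
    sticky D n t (letter n t) < sticky D n t (letter n t + 1) := by
  have hlt : i + j + 1 < n := hD _ hij
  have ht' : t = i * n + (n - (j + 1)) := by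
    apply cellAt_injective (n := n) (by omega)
    rw [ht, show n - (j + 1) = n - 1 - j by omega, cellAt_eq (by omega)]
  obtain ⟨-, hb, hc⟩ := rk_sticky_reading hD q i (j + 1) (by omega)
  rw [← ht'] at hb hc
  rw [letter_eq ht]
  have h0 := hb j (by omega)
  have h1 := hb (j + 1) le_rfl
  have h2 := hc (j + 1) le_rfl
  have e1 := rk_succ (sticky D n t) (i + j) q
  have e2 := rk_succ (sticky D n t) (i + j + 1) q
  rw [← add_assoc] at h1
  rw [← add_assoc] at h2
  unfold chainRank at h0 h1 h2
  have m1 := longest_mono (D := D) (q := q) (le_refl i) (Nat.le_succ j)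
  have m2 := longest_mono (D := D) (q := q) (Nat.le_succ i) (le_refl j)
  have m3 := longest_mono (D := D) (q := q) (Nat.le_succ i) (le_refl (j + 1))
  have m4 := longest_mono (D := D) (q := q) (le_refl (i + 1)) (Nat.le_succ j)
  simp only [Nat.succ_eq_add_one] at m1 m2 m3 m4
  split_ifs at e1 e2 <;> omega

/-! ### Pipes -/

lemma Enters.unique {c c' : ℕ} {d : Side} {i j : ℕ} (h : Enters D c d i j)
    (h' : Enters D c' d i j) : c = c' := by
  induction h generalizing c' with
  | start => cases h'; rfl
  | cross_top hD _ ih =>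
    cases h' with
    | cross_top _ h' => exact ih h'
    | turn_right hD' _ => exact absurd hD hD'
  | turn_top hD _ ih =>
    cases h' with
    | turn_top _ h' => exact ih h'
    | cross_right hD' _ => exact absurd hD' hD
  | cross_right hD _ ih =>
    cases h' with
    | cross_right _ h' => exact ih h'
    | turn_top hD' _ => exact absurd hD hD'
  | turn_right hD _ ih =>
    cases h' with
    | turn_right _ h' => exact ih h'
    | cross_top hD' _ => exact absurd hD' hD

/-- The pipe that starts at the top of column `c` leaves the box `(i, j)` through the left. -/
def LeavesLeft (D : Finset Box) (c i j : ℕ) : Prop :=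
  ((i, j) ∉ D ∧ Enters D c Side.top i j) ∨ ((i, j) ∈ D ∧ Enters D c Side.right i j)

lemma LeavesLeft.enters {c i j : ℕ} (h : LeavesLeft D c i (j + 1)) :
    Enters D c Side.right i j :=
  h.elim (fun h => .turn_top h.1 h.2) fun h => .cross_right h.1 h.2

lemma EndsAt.unique {c c' i : ℕ} (h : EndsAt D c i) (h' : EndsAt D c' i) : c = c' := by
  rcases h with ⟨h1, h2⟩ | ⟨h1, h2⟩ <;> rcases h' with ⟨h3, h4⟩ | ⟨h3, h4⟩
  · exact h2.unique h4
  · exact absurd h3 h1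
  · exact absurd h1 h3
  · exact h2.unique h4

/-- The pipes along the boundary of the region that has been read. -/
lemma enters_reading (hD : ∀ x ∈ D, x ∈ staircase n) (i j : ℕ) (hj : j ≤ n) :
    (∀ m < i, EndsAt D (plain D n (i * n + (n - j)) m) m) ∧
    LeavesLeft D (plain D n (i * n + (n - j)) (i + j)) i j ∧
    (∀ m < j, Enters D (plain D n (i * n + (n - j)) (i + m)) Side.top i m) ∧
    (∀ m, j ≤ m → Enters D (plain D n (i * n + (n - j)) (i + m + 1)) Side.top (i + 1) m) := by
  have turn : ∀ c i m, n ≤ m → Enters D c Side.top i (m + 1) → Enters D c Side.top (i + 1) m :=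
    fun c i m hm h => .turn_right (notMem_of_le hD hm) (.turn_top (notMem_of_le hD (by omega)) h)
  refine reading_induction (n := n) (P := fun t i j =>
    (∀ m < i, EndsAt D (plain D n t m) m) ∧
    LeavesLeft D (plain D n t (i + j)) i j ∧
    (∀ m < j, Enters D (plain D n t (i + m)) Side.top i m) ∧
    (∀ m, j ≤ m → Enters D (plain D n t (i + m + 1)) Side.top (i + 1) m)) ?_ ?_ ?_ i j hj
  · simp only [plain, Perm.one_apply, zero_add]
    exact ⟨fun m hm => absurd hm (by omega), Or.inl ⟨notMem_of_le hD le_rfl, .start⟩,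
      fun m _ => .start, fun m hm => turn _ _ _ hm .start⟩
  · rintro t i j ht ⟨ha, hl, hb, hc⟩
    have htop := hb j (by omega)
    have hright := hl.enters
    rw [plain, ht, letter_eq ht]
    split_ifs with hD'
    · have hne : ∀ m, m ≠ i + j → m ≠ i + j + 1 →
          (plain D n t * swap (i + j) (i + j + 1)) m = plain D n t m :=
        fun m h1 h2 => mul_swap_apply_of_ne _ h1 h2
      refine ⟨fun m hm => ?_, ?_, fun m hm => ?_, fun m hm => ?_⟩
      · rw [hne m (by omega) (by omega)]; exact ha m hm
      · rw [mul_swap_apply_left]; exact Or.inr ⟨hD', hright⟩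
      · rw [hne _ (by omega) (by omega)]; exact hb m (by omega)
      · rcases Nat.eq_or_lt_of_le hm with rfl | hm
        · rw [mul_swap_apply_right]; exact .cross_top hD' htop
        · rw [hne _ (by omega) (by omega)]; exact hc m hm
    · refine ⟨ha, Or.inl ⟨hD', htop⟩, fun m hm => hb m (by omega), fun m hm => ?_⟩
      rcases Nat.eq_or_lt_of_le hm with rfl | hm
      · exact .turn_right hD' hright
      · exact hc m hm
  · rintro t i ⟨ha, hl, hb, hc⟩
    have hc' : ∀ m, Enters D (plain D n t (i + 1 + m)) Side.top (i + 1) m := fun m => by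
      rw [show i + 1 + m = i + m + 1 by omega]; exact hc m (Nat.zero_le _)
    refine ⟨fun m hm => ?_, Or.inl ⟨notMem_of_le hD le_rfl, hc' n⟩, fun m _ => hc' m,
      fun m hm => turn _ _ _ hm (hc' (m + 1))⟩
    rcases Nat.lt_succ_iff_lt_or_eq.1 hm with hm | rfl
    · exact ha m hm
    · exact hl

lemma endsAt_plain (hD : ∀ x ∈ D, x ∈ staircase n) {m : ℕ} (hm : m < n) :
    EndsAt D (plain D n (n * n) m) m := by
  have := (enters_reading hD n n le_rfl).1 m hm
  simpa using this

lemma enters_plain (hD : ∀ x ∈ D, x ∈ staircase n) {t : ℕ} (ht : cellAt n t ∈ D) :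
    Enters D (plain D n t (letter n t)) Side.top (cellAt n t).1 (cellAt n t).2 ∧
      Enters D (plain D n t (letter n t + 1)) Side.right (cellAt n t).1 (cellAt n t).2 := by
  obtain ⟨i, j, hij⟩ : ∃ i j, cellAt n t = (i, j) := ⟨_, _, rfl⟩
  rw [letter_eq hij]
  rw [hij] at ht ⊢
  have hlt : i + j + 1 < n := hD _ ht
  have ht' : t = i * n + (n - (j + 1)) := by
    apply cellAt_injective (n := n) (by omega)
    rw [hij, show n - (j + 1) = n - 1 - j by omega, cellAt_eq (by omega)]
  obtain ⟨-, hl, hb, -⟩ := enters_reading hD i (j + 1) (by omega)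
  rw [← ht'] at hl hb
  exact ⟨hb j (by omega), hl.enters⟩

/-- In a reduced pipe dream, every crossing creates an inversion: two pipes that are inverted have
crossed before. -/
lemma IsReduced.ascending (hD : ∀ x ∈ D, x ∈ staircase n) (hred : IsReduced D) :
    Ascending D n (plain D n) := by
  have key : ∀ t m m', m < m' → plain D n t m' < plain D n t m →
      ∃ s < t, cellAt n s ∈ D ∧ CrossAt D (plain D n t m) (plain D n t m') (cellAt n s) := by
    intro t
    induction t with
    | zero =>
      intro m m' h1 h2
      simp only [plain, Perm.one_apply] at h2
      omega
    | succ t ih =>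
      intro m m' hmm hinv
      rw [plain] at hinv ⊢
      split_ifs at hinv ⊢ with hc
      · set k := letter n t with hk
        by_cases hk' : m = k ∧ m' = k + 1
        · obtain ⟨rfl, rfl⟩ := hk'
          rw [mul_swap_apply_left, mul_swap_apply_right]
          have := enters_plain hD hc
          exact ⟨t, Nat.lt_succ_self t, hc, hc, Or.inr this⟩
        · simp only [Perm.mul_apply] at hinv ⊢
          obtain ⟨s, hs, h⟩ := ih _ _ (swap_succ_lt hmm hk') hinv
          exact ⟨s, by omega, h⟩
      · obtain ⟨s, hs, h⟩ := ih m m' hmm hinv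
        exact ⟨s, by omega, h⟩
  intro t ht
  by_contra hcon
  have hne : plain D n t (letter n t) ≠ plain D n t (letter n t + 1) := fun h => by
    have := (plain D n t).injective h
    omega
  obtain ⟨s, hs, -, hcross⟩ := key t _ _ (Nat.lt_succ_self _)
    (lt_of_le_of_ne (not_lt.1 hcon) hne.symm)
  have := cellAt_injOn hD ht
    (hred _ _ hne _ _ hcross ⟨ht, Or.inl (enters_plain hD ht)⟩)
  omega

/-- If every crossing creates an inversion, then the pipe dream is reduced: once inverted, two pipes
remain inverted. -/
lemma Ascending.isReduced (hD : ∀ x ∈ D, x ∈ staircase n) (hasc : Ascending D n (plain D n)) :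
    IsReduced D := by
  have stay : ∀ t t' c c', t ≤ t' → c < c' → (plain D n t)⁻¹ c' < (plain D n t)⁻¹ c →
      (plain D n t')⁻¹ c' < (plain D n t')⁻¹ c := by
    intro t t' c c' htt hcc h
    induction htt with
    | refl => exact h
    | @step t' _ ih =>
      rw [plain]
      split_ifs with hc
      · rw [mul_inv_rev, swap_inv, Perm.mul_apply, Perm.mul_apply]
        refine swap_succ_lt ih ?_
        rintro ⟨h1, h2⟩
        have := hasc t' hc
        rw [← h2, ← h1] at this
        rw [show ∀ x, plain D n t' ((plain D n t')⁻¹ x) = x from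
          fun x => Equiv.apply_symm_apply _ x] at this
        rw [show ∀ x, plain D n t' ((plain D n t')⁻¹ x) = x from
          fun x => Equiv.apply_symm_apply _ x] at this
        omega
      · exact ih
  have cross : ∀ t c c', c < c' → CrossAt D c c' (cellAt n t) →
      plain D n t (letter n t) = c ∧ plain D n t (letter n t + 1) = c' := by
    rintro t c c' hcc ⟨ht, h⟩
    have h0 := enters_plain hD ht
    have h1 := hasc t ht
    rcases h with h | h
    · exact ⟨h0.1.unique h.1, h0.2.unique h.2⟩
    · rw [h0.1.unique h.1, h0.2.unique h.2] at h1
      omega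
  have main : ∀ t t' c c', c < c' → t < t' → CrossAt D c c' (cellAt n t) →
      ¬ CrossAt D c c' (cellAt n t') := by
    intro t t' c c' hcc htt h h'
    obtain ⟨h1, h2⟩ := cross t c c' hcc h
    obtain ⟨h1', h2'⟩ := cross t' c c' hcc h'
    have hinv : ∀ {w : Perm ℕ} {a b : ℕ}, w a = b → w⁻¹ b = a := fun h => by
      rw [Perm.inv_eq_iff_eq, h]
    have hs : plain D n (t + 1) = plain D n t * swap (letter n t) (letter n t + 1) := by
      rw [plain, if_pos h.1]
    have e1 : plain D n (t + 1) (letter n t) = c' := by rw [hs, mul_swap_apply_left, h2]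
    have e2 : plain D n (t + 1) (letter n t + 1) = c := by rw [hs, mul_swap_apply_right, h1]
    have := stay (t + 1) t' c c' htt hcc (by rw [hinv e1, hinv e2]; omega)
    rw [hinv h1', hinv h2'] at this
    omega
  have lt_case : ∀ c c', c < c' → ∀ x y, CrossAt D c c' x → CrossAt D c c' y → x = y := by
    intro c c' hcc x y hx hy
    obtain ⟨t, -, rfl⟩ := exists_cellAt hD hx.1
    obtain ⟨t', -, rfl⟩ := exists_cellAt hD hy.1
    rcases lt_trichotomy t t' with h | rfl | h
    · exact absurd hy (main t t' c c' hcc h hx)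
    · rfl
    · exact absurd hx (main t' t c c' hcc h hy)
  have symm : ∀ c c' x, CrossAt D c c' x → CrossAt D c' c x := fun c c' x h => ⟨h.1, h.2.symm⟩
  intro c c' hne x y hx hy
  rcases lt_or_gt_of_ne hne with h | h
  · exact lt_case c c' h x y hx hy
  · exact lt_case c' c h x y (symm _ _ _ hx) (symm _ _ _ hy)

end

section

/-! ### Moon polyominoes and their maximal rectangles -/

variable {M : Finset Box} {k : ℕ}

lemma IsConvexPolyomino.row_mem (hM : IsConvexPolyomino M) {i b j y : ℕ} (hj : (i, j) ∈ M)
    (hy : (i, y) ∈ M) (hb : (j ≤ b ∧ b ≤ y) ∨ (y ≤ b ∧ b ≤ j)) : (i, b) ∈ M :=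
  hb.elim (fun h => hM.1 i j b y hj hy h.1 h.2) fun h => hM.1 i y b j hy hj h.1 h.2

lemma IsConvexPolyomino.col_mem (hM : IsConvexPolyomino M) {j c i x : ℕ} (hi : (i, j) ∈ M)
    (hx : (x, j) ∈ M) (hc : (i ≤ c ∧ c ≤ x) ∨ (x ≤ c ∧ c ≤ i)) : (c, j) ∈ M :=
  hc.elim (fun h => hM.2 j i c x hi hx h.1 h.2) fun h => hM.2 j x c i hx hi h.1 h.2

/-- If one leaves `M` from the box `(x, y)` in a vertical direction at `(c, y)` and in a horizontal
direction at `(x, b)`, then the whole quadrant with corner `(c, b)` pointing away from `(x, y)` is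
disjoint from `M`. -/
lemma IsMoonPolyomino.notMem_quadrant (hM : IsMoonPolyomino M) {x y b c i j : ℕ} (hxy : (x, y) ∈ M)
    (hb : (x, b) ∉ M) (hc : (c, y) ∉ M) (hbj : (j ≤ b ∧ b ≤ y) ∨ (y ≤ b ∧ b ≤ j))
    (hci : (i ≤ c ∧ c ≤ x) ∨ (x ≤ c ∧ c ≤ i)) : (i, j) ∉ M := by
  intro h
  rcases hM.2 j y with hsub | hsub
  · exact hc (hM.1.col_mem (hsub h) hxy hci)
  · exact hb (hM.1.row_mem (hsub hxy) hxy hbj)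

/-- The rectangle with corner boxes `(a, b)` and `(c, d)` is contained in `M`. -/
def HasRectangle (M : Finset Box) (a b c d : ℕ) : Prop :=
  ∀ i j, a ≤ i → i ≤ c → b ≤ j → j ≤ d → (i, j) ∈ M

lemma Icc_subset_iff {a b c d : ℕ} : Icc (a, b) (c, d) ⊆ M ↔ HasRectangle M a b c d := by
  constructor
  · intro h i j h1 h2 h3 h4
    exact h (mem_Icc.2 ⟨⟨h1, h3⟩, ⟨h2, h4⟩⟩)
  · rintro h ⟨i, j⟩ hij
    obtain ⟨⟨h1, h3⟩, ⟨h2, h4⟩⟩ := mem_Icc.1 hij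
    exact h i j h1 h2 h3 h4

lemma isMaximalRectangle_iff {a b c d : ℕ} : IsMaximalRectangle M a b c d ↔
    a ≤ c ∧ b ≤ d ∧ HasRectangle M a b c d ∧ ∀ a' b' c' d', a' ≤ a → b' ≤ b → c ≤ c' → d ≤ d' →
      HasRectangle M a' b' c' d' → a' = a ∧ b' = b ∧ c' = c ∧ d' = d := by
  unfold IsMaximalRectangle
  simp only [Icc_subset_iff]
  refine and_congr_right fun hac => and_congr_right fun hbd => and_congr_right fun _ => ⟨?_, ?_⟩
  · intro h a' b' c' d' h1 h2 h3 h4 hR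
    have heq := h a' b' c' d' hR
      (Icc_subset_iff.1 (Icc_subset_Icc (Prod.mk_le_mk.2 ⟨h1, h2⟩) (Prod.mk_le_mk.2 ⟨h3, h4⟩)))
    have e1 : (a', b') ∈ Icc (a, b) (c, d) := by
      rw [← heq]
      exact mem_Icc.2 ⟨le_rfl, ⟨by simp only; omega, by simp only; omega⟩⟩
    have e2 : (c', d') ∈ Icc (a, b) (c, d) := by
      rw [← heq]
      exact mem_Icc.2 ⟨⟨by simp only; omega, by simp only; omega⟩, le_rfl⟩
    obtain ⟨⟨f1, f2⟩, -⟩ := mem_Icc.1 e1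
    obtain ⟨-, ⟨f3, f4⟩⟩ := mem_Icc.1 e2
    simp only at f1 f2 f3 f4
    omega
  · intro h a' b' c' d' hR hsub
    have e1 := mem_Icc.1 (hsub a b le_rfl hac le_rfl hbd)
    have e2 := mem_Icc.1 (hsub c d hac le_rfl hbd le_rfl)
    obtain ⟨rfl, rfl, rfl, rfl⟩ := h a' b' c' d' e1.1.1 e1.1.2 e2.2.1 e2.2.2 hR
    rfl

/-- A rectangle in `M` is maximal if and only if it can be extended in none of the four directions.
-/
lemma isMaximalRectangle_iff_sides {a b c d : ℕ} : IsMaximalRectangle M a b c d ↔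
    a ≤ c ∧ b ≤ d ∧ HasRectangle M a b c d ∧
      (∀ a', a = a' + 1 → ∃ j, b ≤ j ∧ j ≤ d ∧ (a', j) ∉ M) ∧
      (∀ b', b = b' + 1 → ∃ i, a ≤ i ∧ i ≤ c ∧ (i, b') ∉ M) ∧
      (∃ j, b ≤ j ∧ j ≤ d ∧ (c + 1, j) ∉ M) ∧ (∃ i, a ≤ i ∧ i ≤ c ∧ (i, d + 1) ∉ M) := by
  rw [isMaximalRectangle_iff]
  refine and_congr_right fun hac => and_congr_right fun hbd => and_congr_right fun hR => ⟨?_, ?_⟩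
  · intro h
    refine ⟨?_, ?_, ?_, ?_⟩
    · rintro a' rfl
      by_contra! hc
      have := h a' b c d (by omega) le_rfl le_rfl le_rfl fun i j h1 h2 h3 h4 => by
        rcases Nat.eq_or_lt_of_le h1 with rfl | h1
        · exact hc j h3 h4
        · exact hR i j h1 h2 h3 h4
      omega
    · rintro b' rfl
      by_contra! hc
      have := h a b' c d le_rfl (by omega) le_rfl le_rfl fun i j h1 h2 h3 h4 => by
        rcases Nat.eq_or_lt_of_le h3 with rfl | h3
        · exact hc i h1 h2
        · exact hR i j h1 h2 h3 h4
      omega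
    · by_contra! hc
      have := h a b (c + 1) d le_rfl le_rfl (by omega) le_rfl fun i j h1 h2 h3 h4 => by
        rcases Nat.eq_or_lt_of_le h2 with rfl | h2
        · exact hc j h3 h4
        · exact hR i j h1 (by omega) h3 h4
      omega
    · by_contra! hc
      have := h a b c (d + 1) le_rfl le_rfl le_rfl (by omega) fun i j h1 h2 h3 h4 => by
        rcases Nat.eq_or_lt_of_le h4 with rfl | h4
        · exact hc i h1 h2
        · exact hR i j h1 h2 h3 (by omega)
      omega
  · rintro ⟨hN, hW, ⟨y, hy1, hy2, hy⟩, ⟨x, hx1, hx2, hx⟩⟩ a' b' c' d' h1 h2 h3 h4 hR'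
    refine ⟨?_, ?_, ?_, ?_⟩
    · by_contra hne
      obtain ⟨j, j1, j2, hj⟩ := hN (a - 1) (by omega)
      exact hj (hR' _ _ (by omega) (by omega) (by omega) (by omega))
    · by_contra hne
      obtain ⟨i, i1, i2, hi⟩ := hW (b - 1) (by omega)
      exact hi (hR' _ _ (by omega) (by omega) (by omega) (by omega))
    · by_contra hne
      exact hy (hR' _ _ (by omega) (by omega) (by omega) (by omega))
    · by_contra hne
      exact hx (hR' _ _ (by omega) (by omega) (by omega) (by omega))

lemma IsMaximalRectangle.southwest (hM : IsMoonPolyomino M) {a b c d : ℕ}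
    (h : IsMaximalRectangle M a b c d) {i j : ℕ} (hi : c < i) (hj : j < b) : (i, j) ∉ M := by
  obtain ⟨-, -, hR, -, hW, ⟨y, hy1, hy2, hy⟩, -⟩ := isMaximalRectangle_iff_sides.1 h
  obtain ⟨x, hx1, hx2, hx⟩ := hW (b - 1) (by omega)
  exact hM.notMem_quadrant (hR x y hx1 hx2 hy1 hy2) hx hy (Or.inl ⟨by omega, by omega⟩)
    (Or.inr ⟨by omega, hi⟩)

lemma IsMaximalRectangle.northeast (hM : IsMoonPolyomino M) {a b c d : ℕ}
    (h : IsMaximalRectangle M a b c d) {i j : ℕ} (hi : i < a) (hj : d < j) : (i, j) ∉ M := by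
  obtain ⟨-, -, hR, hN, -, -, ⟨x, hx1, hx2, hx⟩⟩ := isMaximalRectangle_iff_sides.1 h
  obtain ⟨y, hy1, hy2, hy⟩ := hN (a - 1) (by omega)
  exact hM.notMem_quadrant (hR x y hx1 hx2 hy1 hy2) hx hy (Or.inr ⟨by omega, hj⟩)
    (Or.inl ⟨by omega, by omega⟩)

lemma HasRectangle.exists_isMaximalRectangle {a b c d : ℕ} (h : HasRectangle M a b c d)
    (hac : a ≤ c) (hbd : b ≤ d) : ∃ a' b' c' d', a' ≤ a ∧ b' ≤ b ∧ c ≤ c' ∧ d ≤ d' ∧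
      IsMaximalRectangle M a' b' c' d' := by
  classical
  obtain ⟨R, hle, hR, hmax⟩ := Finset.exists_le_maximal
    (M.powerset.filter fun R => ∃ a b c d, R = Icc (a, b) (c, d)) (a := Icc (a, b) (c, d))
    (mem_filter.2 ⟨mem_powerset.2 (Icc_subset_iff.2 h), a, b, c, d, rfl⟩)
  obtain ⟨hRM, a', b', c', d', rfl⟩ := mem_filter.1 hR
  have e1 := mem_Icc.1 (hle (mem_Icc.2 ⟨le_rfl, (⟨hac, hbd⟩ : (a, b) ≤ (c, d))⟩))
  have e2 := mem_Icc.1 (hle (mem_Icc.2 ⟨(⟨hac, hbd⟩ : (a, b) ≤ (c, d)), le_rfl⟩))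
  refine ⟨a', b', c', d', e1.1.1, e1.1.2, e2.2.1, e2.2.2, e1.1.1.trans e1.2.1, e1.1.2.trans e1.2.2,
    mem_powerset.1 hRM, fun a'' b'' c'' d'' hsub hsup => ?_⟩
  exact le_antisymm (hmax (mem_filter.2 ⟨mem_powerset.2 hsub, _, _, _, _, rfl⟩) hsup) hsup

/-! ### North-east chains and marked boxes -/

/-- If the rectangle contains no chain of `k + 1` boxes outside `D`, then the longest chains
outside `D` in the rows `≤ c + b` and the columns `≤ d + a` have at most `a + b + k` boxes: at most
`b` boxes lie to the west or to the south of the rectangle, and at most `a` to the north or to the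
east. -/
lemma longest_le_of_rectangle {D : Finset Box} {a b c d k : ℕ}
    (h : ∀ s : Fin (k + 1) → Box,
      (∀ t u : Fin (k + 1), t < u → (s u).1 < (s t).1 ∧ (s t).2 < (s u).2) →
      (∀ t, s t ∉ D ∧ a ≤ (s t).1 ∧ (s t).1 ≤ c ∧ b ≤ (s t).2 ∧ (s t).2 ≤ d) → False) :
    longest D (d + a + 1) (c + b + 1) 0 ≤ a + b + k := by
  by_contra hcon
  have h1 := longest_add_le (D := D) (q := d + a + 1) (x := c + 1) (j := 0) b
  rw [show c + 1 + b = c + b + 1 by omega, zero_add] at h1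
  obtain ⟨s, hs, hs'⟩ := exists_chain_of_le_longest (D := D) (q := d + a + 1) (x := c + 1) (j := b)
    (l := k + 1) (a := a) (by omega)
  refine h s hs fun t => ?_
  have := hs' t
  exact ⟨this.1, this.2.1, by omega, this.2.2.2.1, by omega⟩

lemma longest_le_of_hasRectangle {a b c d : ℕ} (h : HasRectangle M a b c d) :
    longest M (d + a + 1) (c + b + 1) 0 ≤ a + b :=
  longest_le_of_rectangle (k := 0) fun _ _ hs' =>
    (hs' 0).1 (h _ _ (hs' 0).2.1 (hs' 0).2.2.1 (hs' 0).2.2.2.1 (hs' 0).2.2.2.2)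

lemma chain_add_le {k : ℕ} {s : Fin (k + 1) → Box}
    (hs : ∀ t u : Fin (k + 1), t < u → (s u).1 < (s t).1 ∧ (s t).2 < (s u).2) (t : Fin (k + 1)) :
    (s t).1 + t ≤ (s 0).1 ∧ (s 0).2 + t ≤ (s t).2 := by
  induction t using Fin.induction with
  | zero => simp
  | succ t ih =>
    have := hs t.castSucc t.succ Fin.castSucc_lt_succ
    simp only [Fin.val_castSucc, Fin.val_succ] at *
    omega

/-- A filling `F` avoids the forbidden chains in `M` if and only if the longest chains in the
complement of `M \ F`, which contains `F` and all boxes outside `M`, satisfy the bounds given by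
the marked boxes. A forbidden chain in a maximal rectangle is prolonged outside `M` by an
antidiagonal of `a` boxes to the north-east and one of `b` boxes to the south-west. -/
theorem avoidsNEChains_iff (hM : IsMoonPolyomino M) {F : Finset Box} (hF : F ⊆ M) :
    AvoidsNEChains M k F ↔ ∀ p q r, ((p, q), r) ∈ markedBoxes M k →
      longest (M \ F) (q + 1) (p + 1) 0 ≤ r := by
  constructor
  · rintro ⟨-, h⟩ p q r ⟨a, b, c, d, hR, -, -, heq⟩
    obtain ⟨⟨rfl, rfl⟩, rfl⟩ := by simpa only [Prod.mk.injEq] using heq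
    have hR' := (isMaximalRectangle_iff.1 hR).2.2.1
    refine longest_le_of_rectangle fun s hs hs' => h s (fun t => ?_) ⟨hs, fun i j => ?_⟩
    · obtain ⟨h1, h2, h3, h4, h5⟩ := hs' t
      by_contra hF'
      exact h1 (mem_sdiff.2 ⟨hR' _ _ h2 h3 h4 h5, hF'⟩)
    · rintro ⟨t1, h1⟩ ⟨t2, h2⟩ ⟨t3, h3⟩ ⟨t4, h4⟩
      have e1 := hs' t1
      have e2 := hs' t2
      have e3 := hs' t3
      have e4 := hs' t4
      exact hR' i j (by omega) (by omega) (by omega) (by omega)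
  · refine fun h => ⟨hF, fun s hsF hs => ?_⟩
    obtain ⟨hs, hhull⟩ := hs
    have hlen := chain_add_le hs
    have hlast := hlen (Fin.last k)
    have hmono : ∀ t, (s (Fin.last k)).1 ≤ (s t).1 ∧ (s t).1 ≤ (s 0).1 ∧ (s 0).2 ≤ (s t).2 ∧
        (s t).2 ≤ (s (Fin.last k)).2 := fun t => by
      have h1 := hlen t
      rcases Fin.eq_or_lt_of_le (Fin.le_last t) with rfl | h2
      · omega
      · have := hs _ _ h2
        omega
    simp only [Fin.val_last] at hlast
    obtain ⟨a, b, c, d, ha, hb, hc, hd, hR⟩ := HasRectangle.exists_isMaximalRectangle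
      (M := M) (a := (s (Fin.last k)).1) (b := (s 0).2) (c := (s 0).1) (d := (s (Fin.last k)).2)
      (fun i j h1 h2 h3 h4 => hhull i j ⟨_, h1⟩ ⟨_, h2⟩ ⟨_, h3⟩ ⟨_, h4⟩) (by omega) (by omega)
    have hle := h _ _ _ ⟨a, b, c, d, hR, by omega, by omega, rfl⟩
    have hnotMem : ∀ x, x ∉ M → x ∉ M \ F := fun x hx hx' => hx (mem_sdiff.1 hx').1
    have hNE := add_longest_le (D := M \ F) (q := d + a + 1) (x := 0) (j := d + 1) a (by omega)
      fun s hs => hnotMem _ (hR.northeast hM (by omega) (by omega))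
    have hSW := add_longest_le (D := M \ F) (q := d + a + 1) (x := c + 1) (j := 0) b (by omega)
      fun s hs => hnotMem _ (hR.southwest hM (by omega) (by omega))
    have hmid := add_longest_le_of_chain (D := M \ F) (q := d + a + 1) (x := c + 1) (j := b)
      (a := a) (d := d) s hs (fun t => ⟨fun h => (mem_sdiff.1 h).2 (hsF t), by
        have := hmono t
        omega⟩) (by omega) (by omega) (by omega)
    rw [show c + 1 + b = c + b + 1 by omega] at hSW
    simp only [zero_add] at hNE hSW
    omega

/-! ### The essential set of a moon polyomino viewed as a pipe dream -/

/-- A moon polyomino, read as a pipe dream, is reduced: for a box `(i, j)` take a rectangle in `M`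
with south-west corner `(i, j)` that can be extended neither to the north nor to the east. -/
lemma IsMoonPolyomino.ascending {n : ℕ} (hM : IsMoonPolyomino M) (hn : ∀ x ∈ M, x ∈ staircase n) :
    Ascending M n (sticky M n) := by
  classical
  intro t ht
  obtain ⟨i, j, hij⟩ : ∃ i j, cellAt n t = (i, j) := ⟨_, _, rfl⟩
  rw [hij] at ht
  have hex : ∃ a, a ≤ i ∧ ∀ u, a ≤ u → u ≤ i → (u, j) ∈ M :=
    ⟨i, le_rfl, fun u h1 h2 => by rwa [le_antisymm h2 h1]⟩
  obtain ⟨hai, ha⟩ := Nat.find_spec hex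
  have hamin := fun m => Nat.find_min hex (m := m)
  set a := Nat.find hex
  have hex' : ∃ e, j < e ∧ ∃ u, a ≤ u ∧ u ≤ i ∧ (u, e) ∉ M :=
    ⟨n + j + 1, by omega, a, le_rfl, hai, notMem_of_le hn (by omega)⟩
  obtain ⟨hje, u, hu1, hu2, hu⟩ := Nat.find_spec hex'
  have hemin := fun m => Nat.find_min hex' (m := m)
  set e := Nat.find hex'
  have hR : ∀ u v, a ≤ u → u ≤ i → j ≤ v → v < e → (u, v) ∈ M := by
    intro u v h1 h2 h3 h4
    rcases Nat.eq_or_lt_of_le h3 with rfl | h3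
    · exact ha u h1 h2
    · by_contra hc
      exact hemin v h4 ⟨h3, u, h1, h2, hc⟩
  have hNE : ∀ u' v', u' < a → e ≤ v' → (u', v') ∉ M := by
    intro u' v' h1 h2
    have htop : (a - 1, j) ∉ M := fun hc => hamin (a - 1) (by omega) ⟨by omega, fun w h3 h4 => by
      rcases Nat.eq_or_lt_of_le h3 with rfl | h3
      · exact hc
      · exact ha w (by omega) h4⟩
    exact hM.notMem_quadrant (ha u hu1 hu2) hu htop (Or.inr ⟨by omega, h2⟩)
      (Or.inl ⟨by omega, by omega⟩)
  -- the rectangle has the rows `a, …, i` and the columns `j, …, e - 1`; a chain outside `M` in the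
  -- columns `< e + a` has at most `a` boxes, and an antidiagonal to the north-east has `a`
  refine sticky_ascent hn hij ht (q := e + a) (by omega) ?_
  have hlow := add_longest_le (D := M) (q := e + a) (x := 0) (j := e) a le_rfl
    fun s hs => hNE _ _ (by omega) (by omega)
  have hmono := longest_mono (D := M) (q := e + a) hai (Nat.succ_le_of_lt hje)
  simp only [zero_add, Nat.succ_eq_add_one] at hlow hmono
  by_contra hcon
  obtain ⟨s, -, hs⟩ := exists_chain_of_le_longest (D := M) (q := e + a) (x := i + 1) (j := j)
    (l := 1) (a := a) (by omega)
  have := hs 0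
  exact this.1 (hR _ _ this.2.1 (by omega) this.2.2.2.1 (by omega))

/-- The bounds on the longest chains outside `M` that make the box marked by a maximal rectangle an
essential box. -/
lemma IsMaximalRectangle.le_longest (hM : IsMoonPolyomino M) {a b c d : ℕ}
    (h : IsMaximalRectangle M a b c d) :
    a + b ≤ longest M (d + a) (c + b) 0 ∧
    a + b + 1 ≤ longest M (d + a + 1) (c + b + 2) 0 ∧
    a + b + 1 ≤ longest M (d + a + 2) (c + b + 1) 0 := by
  obtain ⟨hac, hbd, hR, hN, hW, ⟨y, hy1, hy2, hy⟩, ⟨x, hx1, hx2, hx⟩⟩ :=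
    isMaximalRectangle_iff_sides.1 h
  -- antidiagonals in the quadrants to the north-east and to the south-west of the rectangle
  have hNE : ∀ q d' t, d < d' → t ≤ a → d' + t ≤ q → t ≤ longest M q t d' := by
    intro q d' t hd ht hq
    have := add_longest_le (D := M) (q := q) (x := 0) (j := d') t hq
      fun s hs => h.northeast hM (by omega) (by omega)
    rw [zero_add] at this
    omega
  have hSW : ∀ q c' t, c < c' → t ≤ b → t ≤ q →
      t + longest M q c' t ≤ longest M q (c' + t) 0 := by
    intro q c' t hc ht hq
    have := add_longest_le (D := M) (q := q) (x := c') (j := 0) t (by omega)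
      fun _ _ => h.southwest hM (by omega) (by omega)
    rwa [zero_add] at this
  refine ⟨?_, ?_, ?_⟩
  · have h1 : a ≤ longest M (d + a) a b := by
      rcases a with _ | a
      · exact Nat.zero_le _
      obtain ⟨y, hy1, hy2, hy⟩ := hN a rfl
      have e1 := hNE (d + (a + 1)) (d + 1) a (by omega) (by omega) (by omega)
      have e2 := longest_cons (D := M) (q := d + (a + 1)) (x := a + 1) (Nat.lt_succ_self a) hy1
        (by omega) hy
      have e3 := longest_mono (D := M) (q := d + (a + 1)) (le_refl a) (Nat.succ_le_succ hy2)
      simp only [Nat.succ_eq_add_one] at e3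
      omega
    have h2 : b + longest M (d + a) a b ≤ longest M (d + a) (c + b) 0 := by
      rcases b with _ | b
      · rw [zero_add]
        exact longest_mono hac le_rfl
      obtain ⟨x, hx1, hx2, hx⟩ := hW b rfl
      have e1 := hSW (d + a) (c + 1) b (by omega) (by omega) (by omega)
      have e2 := longest_cons (D := M) (q := d + a) (Nat.lt_succ_of_le hx2) (le_refl b)
        (by omega) hx
      have e3 := longest_mono (D := M) (q := d + a) hx1 (le_refl (b + 1))
      rw [show c + 1 + b = c + (b + 1) by omega] at e1
      simp only [Nat.succ_eq_add_one] at e2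
      omega
    omega
  · have e1 := hNE (d + a + 1) (d + 1) a (by omega) le_rfl (by omega)
    have e2 := hSW (d + a + 1) (c + 2) b (by omega) le_rfl (by omega)
    have e3 := longest_cons (D := M) (q := d + a + 1) (Nat.lt_succ_self (c + 1)) hy1 (by omega) hy
    have e4 := longest_mono (D := M) (q := d + a + 1) (show a ≤ c + 1 by omega)
      (Nat.succ_le_succ hy2)
    rw [show c + 2 + b = c + b + 2 by omega] at e2
    simp only [Nat.succ_eq_add_one] at e3 e4
    rw [show c + 1 + 1 = c + 2 from rfl] at e3
    omega
  · have e1 := hNE (d + a + 2) (d + 2) a (by omega) le_rfl (by omega)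
    have e2 := hSW (d + a + 2) (c + 1) b (by omega) le_rfl (by omega)
    have e3 := longest_cons (D := M) (q := d + a + 2) (Nat.lt_succ_of_le hx2)
      (show b ≤ d + 1 by omega) (by omega) hx
    have e4 := longest_mono (D := M) (q := d + a + 2) hx1 (le_refl (d + 2))
    rw [show c + 1 + b = c + b + 1 by omega] at e2
    simp only [Nat.succ_eq_add_one] at e3
    rw [show d + 1 + 1 = d + 2 from rfl] at e3
    omega

/-- The row indices of the boxes of `M` in column `j`. -/
def column (M : Finset Box) (j : ℕ) : Finset ℕ := (M.filter fun x => x.2 = j).image Prod.fst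

lemma mem_column {i j : ℕ} : i ∈ column M j ↔ (i, j) ∈ M := by
  simp [column]

/-- A moon polyomino has a row and a column that contain all other rows and columns. -/
lemma IsMoonPolyomino.exists_center (hM : IsMoonPolyomino M) :
    ∃ x y, ∀ i j, (i, j) ∈ M → (x, j) ∈ M ∧ (i, y) ∈ M := by
  rcases M.eq_empty_or_nonempty with rfl | hne
  · exact ⟨0, 0, by simp⟩
  have hsub : ∀ j j', (column M j').card ≤ (column M j).card → ∀ i, (i, j') ∈ M → (i, j) ∈ M := by
    intro j j' hcard i hi
    rcases hM.2 j' j with h | h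
    · exact h hi
    · have hjj : column M j ⊆ column M j' := fun i hi => mem_column.2 (h (mem_column.1 hi))
      rw [← mem_column, eq_of_subset_of_card_le hjj hcard]
      exact mem_column.2 hi
  obtain ⟨⟨x, j₀⟩, hx, hmin⟩ := exists_min_image M (fun x => (column M x.2).card) hne
  obtain ⟨⟨i₀, y⟩, hy, hmax⟩ := exists_max_image M (fun x => (column M x.2).card) hne
  exact ⟨x, y, fun i j h => ⟨hsub j j₀ (hmin _ h) x hx, hsub y j (hmax _ h) i h⟩⟩

/-- If the chains outside a moon polyomino `M` in the first `r + h + 1` rows and the first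
`r + v + 1` columns have at most `r` boxes, then one of the `r + 1` translates along the antidiagonal of a
rectangle of `h + 1` rows and `v + 1` columns is contained in `M`. Otherwise every translate has a
corner outside `M`, at which the quadrant pointing away from the centre of `M` is disjoint from
`M`. The translates with a bad north-east corner come first, those with a bad south-west corner
come last, and those in between all have a bad north-west corner or all have a bad south-east
corner; so these corners form a chain of length `r + 1`. -/
theorem IsMoonPolyomino.exists_hasRectangle (hM : IsMoonPolyomino M) {r h v : ℕ}
    (hlong : longest M (r + v + 1) (r + h + 1) 0 ≤ r) :
    ∃ a ≤ r, HasRectangle M a (r - a) (a + h) (r - a + v) := by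
  classical
  by_contra! hcon
  obtain ⟨x, y, hxy⟩ := hM.exists_center
  have star : ∀ {i j u w : ℕ}, (u, w) ∉ M → ((i ≤ u ∧ u ≤ x) ∨ (x ≤ u ∧ u ≤ i)) →
      ((j ≤ w ∧ w ≤ y) ∨ (y ≤ w ∧ w ≤ j)) → (i, j) ∉ M := by
    intro i j u w huw hu hw hij
    have h1 : (u, j) ∈ M := hM.1.col_mem hij (hxy i j hij).1 hu
    exact huw (hM.1.row_mem h1 (hxy u j h1).2 hw)
  set NE : ℕ → Prop := fun a => (a, r - a + v) ∉ M ∧ a ≤ x ∧ y ≤ r - a + v with hNE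
  set SW : ℕ → Prop := fun a => (a + h, r - a) ∉ M ∧ x ≤ a + h ∧ r - a ≤ y with hSW
  set NW : ℕ → Prop := fun a => (a, r - a) ∉ M ∧ a ≤ x ∧ r - a ≤ y with hNW
  set SE : ℕ → Prop := fun a => (a + h, r - a + v) ∉ M ∧ x ≤ a + h ∧ y ≤ r - a + v with hSE
  have bad : ∀ a ≤ r, NE a ∨ SW a ∨ NW a ∨ SE a := by
    intro a ha
    have := hcon a ha
    unfold HasRectangle at this
    push Not at this
    obtain ⟨i, j, h1, h2, h3, h4, hij⟩ := this
    rcases le_total i x with hi | hi <;> rcases le_total j y with hj | hj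
    · exact Or.inr (Or.inr (Or.inl ⟨star hij (Or.inl ⟨h1, hi⟩) (Or.inl ⟨h3, hj⟩), by omega,
        by omega⟩))
    · exact Or.inl ⟨star hij (Or.inl ⟨h1, hi⟩) (Or.inr ⟨hj, h4⟩), by omega, by omega⟩
    · exact Or.inr (Or.inl ⟨star hij (Or.inr ⟨hi, h2⟩) (Or.inl ⟨h3, hj⟩), by omega, by omega⟩)
    · exact Or.inr (Or.inr (Or.inr ⟨star hij (Or.inr ⟨hi, h2⟩) (Or.inr ⟨hj, h4⟩), by omega,
        by omega⟩))
  have NEdown : ∀ a a', a' ≤ a → a ≤ r → NE a → NE a' := by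
    rintro a a' haa har ⟨h1, h2, h3⟩
    exact ⟨star h1 (Or.inl ⟨haa, h2⟩) (Or.inr ⟨h3, by omega⟩), by omega, by omega⟩
  have SWup : ∀ a a', a ≤ a' → a' ≤ r → SW a → SW a' := by
    rintro a a' haa har ⟨h1, h2, h3⟩
    exact ⟨star h1 (Or.inr ⟨h2, by omega⟩) (Or.inl ⟨by omega, h3⟩), by omega, by omega⟩
  have mixed : ∀ a a', a ≤ r → a' ≤ r → NW a → SE a' → (NE a ∨ SW a) ∨ (NE a' ∨ SW a') := by
    rintro a a' har har' ⟨h1, h2, h3⟩ ⟨h4, h5, h6⟩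
    have hor : (a, r - a' + v) ∉ M ∨ (a' + h, r - a) ∉ M := by
      rcases hM.2 (r - a) (r - a' + v) with hs | hs
      · exact Or.inr fun hc => h4 (hs hc)
      · exact Or.inl fun hc => h1 (hs hc)
    rcases hor with hor | hor <;> rcases le_total a a' with haa | haa
    · exact Or.inl (Or.inl ⟨star hor (Or.inl ⟨le_rfl, h2⟩) (Or.inr ⟨h6, by omega⟩), h2, by omega⟩)
    · exact Or.inr (Or.inl ⟨star hor (Or.inl ⟨haa, h2⟩) (Or.inr ⟨h6, le_rfl⟩), by omega, h6⟩)
    · exact Or.inr (Or.inr ⟨star hor (Or.inr ⟨h5, le_rfl⟩) (Or.inl ⟨by omega, h3⟩), h5, by omega⟩)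
    · exact Or.inl (Or.inr ⟨star hor (Or.inr ⟨h5, by omega⟩) (Or.inl ⟨le_rfl, h3⟩), by omega, h3⟩)
  have hexA : ∃ A, A = r + 1 ∨ ¬ NE A := ⟨r + 1, Or.inl rfl⟩
  have hexB : ∃ B, B = r + 1 ∨ SW B := ⟨r + 1, Or.inl rfl⟩
  have hA := Nat.find_spec hexA
  have hAmin := fun m => Nat.find_min hexA (m := m)
  have hA' := Nat.find_min' hexA (Or.inl rfl)
  have hB := Nat.find_spec hexB
  have hBmin := fun m => Nat.find_min hexB (m := m)
  have hB' := Nat.find_min' hexB (Or.inl rfl)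
  set A := Nat.find hexA
  set B := Nat.find hexB
  obtain ⟨C, hCA, hCB, hC⟩ : ∃ C, C ≤ A ∧ C ≤ B ∧ (C = A ∨ C = B) :=
    ⟨min A B, min_le_left _ _, min_le_right _ _, by omega⟩
  have first : ∀ a < C, NE a := fun a ha => by
    have := hAmin a (by omega)
    push Not at this
    exact this.2
  have last : ∀ a, B ≤ a → a ≤ r → SW a := fun a h1 h2 =>
    SWup B a h1 h2 (hB.resolve_left (by omega))
  have middle : ∀ a, C ≤ a → a < B → ¬ (NE a ∨ SW a) := by
    rintro a h1 h2 (h3 | h3)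
    · exact hA.resolve_left (by omega) (NEdown a A (by omega) (by omega) h3)
    · exact hBmin a h2 (Or.inr h3)
  have mid : (∀ a, C ≤ a → a < B → NW a) ∨ (∀ a, C ≤ a → a < B → SE a) := by
    by_contra! hc
    obtain ⟨⟨a, a1, a2, ha⟩, ⟨a', a1', a2', ha'⟩⟩ := hc
    have m1 := middle a a1 a2
    have m2 := middle a' a1' a2'
    have b1 : SE a := by
      rcases bad a (by omega) with h | h | h | h
      exacts [(m1 (Or.inl h)).elim, (m1 (Or.inr h)).elim, (ha h).elim, h]
    have b2 : NW a' := by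
      rcases bad a' (by omega) with h | h | h | h
      exacts [(m2 (Or.inl h)).elim, (m2 (Or.inr h)).elim, h, (ha' h).elim]
    exact (mixed a' a (by omega) (by omega) b2 b1).elim m2 m1
  have chain1 := add_longest_le (D := M) (q := r + v + 1) (x := B + h) (j := 0) (r + 1 - B)
    (by omega) (fun s hs => by
      have := (last (B + s) (by omega) (by omega)).1
      rwa [show B + s + h = B + h + s by omega,
        show r - (B + s) = 0 + (r + 1 - B - 1 - s) by omega] at this)
  have chain3 := add_longest_le (D := M) (q := r + v + 1) (x := 0) (j := r + 1 - C + v) C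
    (by omega) (fun s hs => by
      have := (first s hs).1
      rw [zero_add]
      rwa [show r - s + v = r + 1 - C + v + (C - 1 - s) by omega] at this)
  rw [show B + h + (r + 1 - B) = r + h + 1 by omega, zero_add] at chain1
  rw [zero_add] at chain3
  have chain2 : B - C + longest M (r + v + 1) C (r + 1 - C + v) ≤
      longest M (r + v + 1) (B + h) (r + 1 - B) := by
    rcases mid with mid | mid
    · have e1 := add_longest_le (D := M) (q := r + v + 1) (x := C) (j := r + 1 - B) (B - C)
        (by omega) (fun s hs => by
          have := (mid (C + s) (by omega) (by omega)).1
          rwa [show r - (C + s) = r + 1 - B + (B - C - 1 - s) by omega] at this)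
      have e2 := longest_mono (D := M) (q := r + v + 1) (le_refl C)
        (show r + 1 - B + (B - C) ≤ r + 1 - C + v by omega)
      have e3 := longest_mono (D := M) (q := r + v + 1) (show C + (B - C) ≤ B + h by omega)
        (le_refl (r + 1 - B))
      omega
    · have e1 := add_longest_le (D := M) (q := r + v + 1) (x := C + h) (j := r + 1 - B + v) (B - C)
        (by omega) (fun s hs => by
          have := (mid (C + s) (by omega) (by omega)).1
          rwa [show C + s + h = C + h + s by omega,
            show r - (C + s) + v = r + 1 - B + v + (B - C - 1 - s) by omega] at this)
      have e2 := longest_mono (D := M) (q := r + v + 1) (show C ≤ C + h by omega)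
        (show r + 1 - B + v + (B - C) ≤ r + 1 - C + v by omega)
      have e3 := longest_mono (D := M) (q := r + v + 1) (show C + h + (B - C) ≤ B + h by omega)
        (show r + 1 - B ≤ r + 1 - B + v by omega)
      omega
  omega

/-- The essential boxes of the Demazure product of a moon polyomino are the boxes marked by its
maximal rectangles. -/
theorem IsMoonPolyomino.isEssential_iff {n : ℕ} (hM : IsMoonPolyomino M)
    (hn : ∀ x ∈ M, x ∈ staircase n) (p q r : ℕ) :
    (IsEssential (sticky M n (n * n)) p q ∧ r = rk (sticky M n (n * n)) (p + 1) (q + 1)) ↔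
      ((p, q), r) ∈ markedBoxes M 0 := by
  set w := sticky M n (n * n) with hw
  have hrk : ∀ {p}, p ≤ n → ∀ q, rk w p q = longest M q p 0 := fun hp q => rk_sticky hn hp q
  constructor
  · rintro ⟨hess, rfl⟩
    have hlt := hess.1.lt (n := n) (fun i hi => sticky_apply_of_le hn _ hi)
    obtain ⟨e1, e2, e3⟩ := (isEssential_iff_rk w p q).1 hess
    have e4 := rk_succ w p q
    have e5 := rk_succ_right w p q
    rw [hrk (by omega)] at e1 e2 e3
    rw [hrk (by omega)] at e1 e2 e3
    rw [hrk (by omega)] at e4 e5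
    rw [hrk (by omega)] at e4 e5
    rw [hrk (by omega)]
    set r := longest M (q + 1) (p + 1) 0 with hr
    have hrp : r ≤ p := e1 ▸ longest_le_left
    have hrq : r ≤ q := by
      rw [e1]
      simpa using longest_add_le_of_le (D := M) (q := q) (x := p) (j := 0) (Nat.zero_le _)
    obtain ⟨a, har, hR⟩ := hM.exists_hasRectangle (r := r) (h := p - r) (v := q - r) (by
      rw [show r + (q - r) + 1 = q + 1 by omega, show r + (p - r) + 1 = p + 1 by omega])
    obtain ⟨b, hb⟩ := Nat.exists_eq_add_of_le har
    rw [show r - a = b by omega] at hR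
    have hc : a + (p - r) + b = p := by omega
    have hd : b + (q - r) + a = q := by omega
    refine ⟨a, b, a + (p - r), b + (q - r), isMaximalRectangle_iff_sides.2
      ⟨by omega, by omega, hR, ?_, ?_, ?_, ?_⟩, by omega, by omega, by rw [hc, hd, hb]; simp⟩
    · rintro a' rfl
      by_contra! hcon
      have := longest_le_of_hasRectangle (M := M) (a := a') (b := b) (c := a' + 1 + (p - r))
        (d := b + (q - r)) fun i j h1 h2 h3 h4 => by
          rcases Nat.eq_or_lt_of_le h1 with rfl | h1
          · exact hcon j h3 h4
          · exact hR i j h1 h2 h3 h4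
      rw [hc, show b + (q - r) + a' + 1 = q by omega] at this
      have := longest_le_succ (D := M) (q := q) (x := p) (j := 0)
      omega
    · rintro b' rfl
      by_contra! hcon
      have := longest_le_of_hasRectangle (M := M) (a := a) (b := b') (c := a + (p - r))
        (d := b' + 1 + (q - r)) fun i j h1 h2 h3 h4 => by
          rcases Nat.eq_or_lt_of_le h3 with rfl | h3
          · exact hcon i h1 h2
          · exact hR i j h1 h2 h3 h4
      rw [hd, show a + (p - r) + b' + 1 = p by omega] at this
      omega
    · by_contra! hcon
      have := longest_le_of_hasRectangle (M := M) (a := a) (b := b) (c := a + (p - r) + 1)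
        (d := b + (q - r)) fun i j h1 h2 h3 h4 => by
          rcases Nat.eq_or_lt_of_le h2 with rfl | h2
          · exact hcon j h3 h4
          · exact hR i j h1 (by omega) h3 h4
      rw [hd, show a + (p - r) + 1 + b + 1 = p + 2 by omega] at this
      omega
    · by_contra! hcon
      have := longest_le_of_hasRectangle (M := M) (a := a) (b := b) (c := a + (p - r))
        (d := b + (q - r) + 1) fun i j h1 h2 h3 h4 => by
          rcases Nat.eq_or_lt_of_le h4 with rfl | h4
          · exact hcon i h1 h2
          · exact hR i j h1 h2 h3 (by omega)
      rw [hc, show b + (q - r) + 1 + a + 1 = q + 2 by omega] at this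
      omega
  · rintro ⟨a, b, c, d, hR, -, -, heq⟩
    obtain ⟨⟨rfl, rfl⟩, rfl⟩ := by simpa only [Prod.mk.injEq] using heq
    obtain ⟨hac, hbd, hR', -⟩ := isMaximalRectangle_iff.1 hR
    have hcd : c + d + 1 < n := hn _ (hR' c d hac le_rfl hbd le_rfl)
    have hle := longest_le_of_hasRectangle hR'
    obtain ⟨h1, h2, h3⟩ := hR.le_longest hM
    rw [← hrk (by omega)] at hle h1 h2 h3
    have e1 := rk_succ w (c + b) (d + a + 1)
    have e2 := rk_succ_right w (c + b) (d + a)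
    have e3 : rk w (c + b + 2) (d + a + 1) = _ := rk_succ w (c + b + 1) (d + a + 1)
    have e4 : rk w (c + b + 1) (d + a + 2) = _ := rk_succ_right w (c + b + 1) (d + a + 1)
    rw [isEssential_iff_rk]
    split_ifs at e1 e2 e3 e4 <;> omega

/-! ### The erosion of a moon polyomino -/

/-- The south-west corners of the squares of side length `k + 1` contained in `M`. -/
def erosion (M : Finset Box) (k : ℕ) : Finset Box :=
  M.filter fun x => k ≤ x.1 ∧ ∀ u ∈ Icc (x.1 - k) x.1, ∀ v ∈ Icc x.2 (x.2 + k), (u, v) ∈ M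

lemma mem_erosion {i j : ℕ} : (i, j) ∈ erosion M k ↔
    k ≤ i ∧ ∀ u v, i ≤ u + k → u ≤ i → j ≤ v → v ≤ j + k → (u, v) ∈ M := by
  simp only [erosion, mem_filter, mem_Icc, and_imp]
  constructor
  · rintro ⟨-, h1, h2⟩
    exact ⟨h1, fun u v h3 h4 h5 h6 => h2 u (by omega) h4 v h5 h6⟩
  · rintro ⟨h1, h2⟩
    exact ⟨h2 i j (by omega) le_rfl le_rfl (by omega), h1,
      fun u h3 h4 v h5 h6 => h2 u v (by omega) h4 h5 h6⟩

lemma erosion_subset : erosion M k ⊆ M := filter_subset _ _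

lemma IsMoonPolyomino.erosion (hM : IsMoonPolyomino M) : IsMoonPolyomino (erosion M k) := by
  refine ⟨⟨fun i j₁ j j₂ h1 h2 h3 h4 => ?_, fun j i₁ i i₂ h1 h2 h3 h4 => ?_⟩, fun j₁ j₂ => ?_⟩
  · rw [mem_erosion] at h1 h2 ⊢
    exact ⟨h1.1, fun u v h5 h6 h7 h8 => hM.1.1 u j₁ v (j₂ + k)
      (h1.2 u j₁ h5 h6 le_rfl (by omega)) (h2.2 u _ h5 h6 (by omega) le_rfl) (by omega) (by omega)⟩
  · rw [mem_erosion] at h1 h2 ⊢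
    exact ⟨by omega, fun u v h5 h6 h7 h8 => hM.1.2 v (i₁ - k) u i₂
      (h1.2 _ v (by omega) (by omega) h7 h8) (h2.2 _ v (by omega) le_rfl h7 h8) (by omega)
      (by omega)⟩
  · by_contra! hcon
    obtain ⟨h1, h2⟩ := hcon
    rw [Set.not_subset] at h1 h2
    obtain ⟨i₁, h1, h1'⟩ := h1
    obtain ⟨i₂, h2, h2'⟩ := h2
    simp only [Set.mem_ofPred_eq, mem_erosion, not_and, not_forall] at h1 h1' h2 h2'
    obtain ⟨u, w, e1, e2, e3, e4, huw⟩ := h1' h1.1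
    obtain ⟨u', w', e1', e2', e3', e4', huw'⟩ := h2' h2.1
    rcases hM.2 w w' with hs | hs
    · exact huw' (hs (h2.2 u' w e1' e2' e3 e4))
    · exact huw (hs (h1.2 u w' e1 e2 e3' e4'))

lemma HasRectangle.of_erosion {a b c d : ℕ} (h : HasRectangle (erosion M k) (a + k) b c d)
    (hac : a + k ≤ c) (hbd : b ≤ d) : HasRectangle M a b c (d + k) := by
  intro i j h1 h2 h3 h4
  have := h (max i (a + k)) (min j d) (by omega) (by omega) (by omega) (by omega)
  exact (mem_erosion.1 this).2 i j (by omega) (by omega) (by omega) (by omega)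

lemma HasRectangle.erosion {a b c d : ℕ} (h : HasRectangle M a b c (d + k)) :
    HasRectangle (erosion M k) (a + k) b c d := by
  intro i j h1 h2 h3 h4
  exact mem_erosion.2 ⟨by omega, fun u v h5 h6 h7 h8 =>
    h u v (by omega) (by omega) (by omega) (by omega)⟩

lemma HasRectangle.le_of_erosion {a b c d : ℕ} (h : HasRectangle (MoonFilling.erosion M k) a b c d)
    (hac : a ≤ c) (hbd : b ≤ d) : k ≤ a :=
  (mem_erosion.1 (h a b le_rfl hac le_rfl hbd)).1

/-- Maximal rectangles of the erosion are those of `M` that are large enough, with `k` rows removed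
in the north and `k` columns removed in the east. -/
lemma isMaximalRectangle_erosion {a b c d : ℕ} (hac : a + k ≤ c) (hbd : b ≤ d) :
    IsMaximalRectangle (erosion M k) (a + k) b c d ↔ IsMaximalRectangle M a b c (d + k) := by
  rw [isMaximalRectangle_iff, isMaximalRectangle_iff]
  constructor
  · rintro ⟨-, -, hR, hmax⟩
    refine ⟨by omega, by omega, hR.of_erosion hac hbd, fun a' b' c' d' h1 h2 h3 h4 hR' => ?_⟩
    obtain ⟨e, rfl⟩ : ∃ e, d' = e + k := ⟨d' - k, by omega⟩
    have := hmax (a' + k) b' c' e (by omega) h2 h3 (by omega) hR'.erosion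
    omega
  · rintro ⟨-, -, hR, hmax⟩
    refine ⟨hac, hbd, hR.erosion, fun a' b' c' d' h1 h2 h3 h4 hR' => ?_⟩
    have hk := hR'.le_of_erosion (by omega) (by omega)
    obtain ⟨e, rfl⟩ : ∃ e, a' = e + k := ⟨a' - k, by omega⟩
    have := hmax e b' c' (d' + k) (by omega) h2 h3 (by omega) (hR'.of_erosion (by omega) (by omega))
    omega

lemma markedBoxes_erosion : markedBoxes (erosion M k) 0 = markedBoxes M k := by
  ext y
  constructor
  · rintro ⟨a, b, c, d, hR, -, -, rfl⟩
    obtain ⟨hac, hbd, hR', -⟩ := isMaximalRectangle_iff.1 hR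
    have hk := hR'.le_of_erosion hac hbd
    obtain ⟨e, rfl⟩ : ∃ e, a = e + k := ⟨a - k, by omega⟩
    refine ⟨e, b, c, d + k, (isMaximalRectangle_erosion hac hbd).1 hR, by omega, by omega, ?_⟩
    refine Prod.ext (Prod.ext ?_ ?_) ?_ <;> simp only <;> omega
  · rintro ⟨a, b, c, d, hR, hc, hd, rfl⟩
    obtain ⟨e, rfl⟩ : ∃ e, d = e + k := ⟨d - k, by omega⟩
    refine ⟨a + k, b, c, e, (isMaximalRectangle_erosion (by omega) (by omega)).2 hR, by omega,
      by omega, ?_⟩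
    refine Prod.ext (Prod.ext ?_ ?_) ?_ <;> simp only <;> omega

/-- The boxes of `M` that are not south-west corners of large squares avoid the forbidden chains:
the rectangle spanned by a forbidden chain contains a large square at its south-west corner. -/
lemma avoidsNEChains_sdiff_erosion : AvoidsNEChains M k (M \ erosion M k) := by
  refine ⟨sdiff_subset, fun s hs ⟨hchain, hhull⟩ => ?_⟩
  have hlast := chain_add_le hchain (Fin.last k)
  simp only [Fin.val_last] at hlast
  refine (mem_sdiff.1 (hs 0)).2 (mem_erosion.2 ⟨by omega, fun u v h1 h2 h3 h4 => ?_⟩)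
  exact hhull u v ⟨Fin.last k, by omega⟩ ⟨0, h2⟩ ⟨0, h3⟩ ⟨Fin.last k, by omega⟩

end

section

/-! ### Permutations of `{0, …, n-1}` -/

variable {n : ℕ}

/-- The permutation of `ℕ` that extends `σ` by the identity. -/
def toPermNat (σ : Perm (Fin n)) : Perm ℕ := σ.extendDomain Fin.equivSubtype

lemma toPermNat_apply (σ : Perm (Fin n)) (i : Fin n) : toPermNat σ i = σ i :=
  σ.extendDomain_apply_image Fin.equivSubtype i

lemma toPermNat_apply_of_le (σ : Perm (Fin n)) {i : ℕ} (hi : n ≤ i) : toPermNat σ i = i :=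
  σ.extendDomain_apply_not_subtype Fin.equivSubtype (not_lt.2 hi)

lemma toPermNat_injective : Function.Injective (toPermNat (n := n)) := by
  intro σ τ h
  ext i
  rw [← toPermNat_apply, ← toPermNat_apply, h]

lemma exists_toPermNat_eq {w : Perm ℕ} (hw : ∀ i, n ≤ i → w i = i) :
    ∃ σ : Perm (Fin n), toPermNat σ = w := by
  have hlt : ∀ i, i < n → w i < n := fun i hi => by
    by_contra hc
    have := w.injective (hw (w i) (not_lt.1 hc))
    omega
  have hinj : Function.Injective fun i : Fin n => (⟨w i, hlt i i.2⟩ : Fin n) := by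
    intro i j h
    exact Fin.ext (w.injective (by simpa using h))
  refine ⟨Equiv.ofBijective _ (Finite.injective_iff_bijective.1 hinj), ?_⟩
  ext i
  rcases Nat.lt_or_ge i n with hi | hi
  · exact toPermNat_apply _ ⟨i, hi⟩
  · rw [toPermNat_apply_of_le _ hi, hw i hi]

lemma mem_rotheDiagram_iff {σ : Perm (Fin n)} {p q : ℕ} :
    (p, q) ∈ rotheDiagram σ ↔ InDiagram (toPermNat σ) p q := by
  constructor
  · rintro ⟨i, j, hij, hσ, heq⟩
    obtain ⟨rfl, rfl⟩ := by simpa only [Prod.mk.injEq] using heq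
    refine ⟨by rw [toPermNat_apply]; exact hσ, ?_⟩
    rw [show (toPermNat σ)⁻¹ (σ j : ℕ) = j by rw [Perm.inv_eq_iff_eq, toPermNat_apply]]
    exact hij
  · intro h
    obtain ⟨hp, hq⟩ := h.lt (n := n) fun i => toPermNat_apply_of_le σ
    have hσ := toPermNat_apply σ (σ⁻¹ ⟨q, by omega⟩)
    rw [show σ (σ⁻¹ ⟨q, by omega⟩) = ⟨q, by omega⟩ from Equiv.apply_symm_apply σ _] at hσ
    have hinv : (toPermNat σ)⁻¹ q = (σ⁻¹ ⟨q, by omega⟩ : Fin n) := by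
      rw [Perm.inv_eq_iff_eq, hσ]
    refine ⟨⟨p, by omega⟩, σ⁻¹ ⟨q, by omega⟩, ?_, ?_, ?_⟩
    · have := h.2
      rw [hinv] at this
      exact this
    · have := h.1
      rw [show p = ((⟨p, by omega⟩ : Fin n) : ℕ) from rfl, toPermNat_apply] at this
      rw [show σ (σ⁻¹ ⟨q, by omega⟩) = ⟨q, by omega⟩ from Equiv.apply_symm_apply σ _]
      exact this
    · rw [show σ (σ⁻¹ ⟨q, by omega⟩) = ⟨q, by omega⟩ from Equiv.apply_symm_apply σ _]

lemma rankAt_eq {σ : Perm (Fin n)} {p q : ℕ} (hp : p < n) :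
    rankAt σ p q = rk (toPermNat σ) (p + 1) (q + 1) := by
  unfold rankAt rk
  rw [← card_filter]
  refine card_bij (fun i _ => (i : ℕ)) ?_ ?_ ?_
  · intro i hi
    simp only [mem_filter, mem_univ, true_and, mem_range] at hi ⊢
    rw [toPermNat_apply]
    omega
  · intro i _ j _ h
    exact Fin.ext h
  · intro i hi
    simp only [mem_filter, mem_range] at hi
    refine ⟨⟨i, by omega⟩, ?_, rfl⟩
    have := toPermNat_apply σ ⟨i, by omega⟩
    simp only at this
    simp only [mem_filter, mem_univ, true_and]
    omega

lemma mem_essentialSet_iff {σ : Perm (Fin n)} {p q r : ℕ} : ((p, q), r) ∈ essentialSet σ ↔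
    IsEssential (toPermNat σ) p q ∧ r = rk (toPermNat σ) (p + 1) (q + 1) := by
  unfold essentialSet IsEssential
  simp only [Set.mem_ofPred_eq, mem_rotheDiagram_iff, Prod.mk.injEq]
  constructor
  · rintro ⟨p, q, h1, h2, h3, ⟨rfl, rfl⟩, rfl⟩
    have := h1.lt (n := n) fun i => toPermNat_apply_of_le σ
    exact ⟨⟨h1, h2, h3⟩, rankAt_eq (by omega)⟩
  · rintro ⟨⟨h1, h2, h3⟩, rfl⟩
    have := h1.lt (n := n) fun i => toPermNat_apply_of_le σ
    exact ⟨p, q, h1, h2, h3, ⟨rfl, rfl⟩, (rankAt_eq (by omega)).symm⟩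

/-- If the ranks of `w` on the essential set of `σ` are bounded by the labels, then so are all
ranks. -/
lemma rk_le_of_essentialSet {σ : Perm (Fin n)} {w : Perm ℕ}
    (h : ∀ p q r, ((p, q), r) ∈ essentialSet σ → rk w (p + 1) (q + 1) ≤ r) (p q : ℕ) :
    rk w p q ≤ rk (toPermNat σ) p q :=
  rk_le_of_essential (fun _ => toPermNat_apply_of_le σ)
    (fun p q hess => h p q _ (mem_essentialSet_iff.2 ⟨hess, rfl⟩)) p q

lemma essentialSet_injective : Function.Injective (essentialSet (n := n)) := by
  have key : ∀ σ τ : Perm (Fin n), essentialSet σ = essentialSet τ → ∀ p q,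
      rk (toPermNat τ) p q ≤ rk (toPermNat σ) p q := fun σ τ h =>
    rk_le_of_essentialSet fun p q r hr => by
      rw [h, mem_essentialSet_iff] at hr
      exact hr.2.ge
  intro σ τ h
  exact toPermNat_injective (eq_of_rk_eq fun p q =>
    le_antisymm (key τ σ h.symm p q) (key σ τ h p q))

/-! ### Reduced pipe dreams as reduced words -/

/-- The reduced pipe dreams for `σ` are the words with Demazure product `σ` all of whose letters
create an inversion. -/
lemma mem_reducedPipeDreams_iff {σ : Perm (Fin n)} {D : Finset Box} :
    D ∈ reducedPipeDreams σ ↔ (∀ x ∈ D, x ∈ staircase n) ∧ Ascending D n (sticky D n) ∧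
      sticky D n (n * n) = toPermNat σ := by
  constructor
  · rintro ⟨hD, hperm, hred⟩
    have hasc := hred.ascending hD
    have heq := hasc.plain_eq_sticky
    refine ⟨hD, fun t => by rw [← heq]; exact hasc t, ?_⟩
    ext m
    rcases Nat.lt_or_ge m n with hm | hm
    · rw [← heq]
      rw [(endsAt_plain hD hm).unique (hperm ⟨m, hm⟩)]
      exact (toPermNat_apply σ ⟨m, hm⟩).symm
    · rw [sticky_apply_of_le hD _ hm, toPermNat_apply_of_le σ hm]
  · rintro ⟨hD, hasc, hσ⟩
    have heq := hasc.sticky_eq_plain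
    refine ⟨hD, fun i => ?_, Ascending.isReduced hD fun t => by rw [← heq]; exact hasc t⟩
    have := endsAt_plain hD i.2
    rwa [← heq, hσ, toPermNat_apply] at this

lemma card_inversions_of_mem {σ : Perm (Fin n)} {D : Finset Box} (h : D ∈ reducedPipeDreams σ) :
    (inversions n (toPermNat σ)).card = D.card := by
  obtain ⟨hD, hasc, hσ⟩ := mem_reducedPipeDreams_iff.1 h
  have heq := hasc.sticky_eq_plain
  rw [← hσ, heq, Ascending.card_inversions hD (fun t => by rw [← heq]; exact hasc t),
    countCells_eq_card hD]

/-- A set of boxes whose Demazure product is bounded by `σ` has at least as many boxes as the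
reduced pipe dreams for `σ`, with equality only for these. -/
lemma card_le_of_rk_le {σ : Perm (Fin n)} {D : Finset Box} (hD : ∀ x ∈ D, x ∈ staircase n)
    (h : ∀ p q, rk (sticky D n (n * n)) p q ≤ rk (toPermNat σ) p q) :
    (inversions n (toPermNat σ)).card ≤ D.card ∧
      ((inversions n (toPermNat σ)).card = D.card → D ∈ reducedPipeDreams σ) := by
  obtain ⟨h1, h2⟩ := card_inversions_le hD (n * n) (toPermNat σ) h
  rw [countCells_eq_card hD] at h1 h2
  refine ⟨h1, fun heq => mem_reducedPipeDreams_iff.2 ⟨hD, fun t ht => ?_, (h2 heq).1⟩⟩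
  obtain ⟨s, hs, hst⟩ := exists_cellAt hD ht
  obtain rfl := cellAt_injOn hD ht hst
  exact (h2 heq).2 s hs ht

/-! ### Maximal fillings and reduced pipe dreams -/

/-- The complement of a set without forbidden chains has a Demazure product bounded by the
permutation whose essential set is given by the marked boxes. -/
lemma rk_sticky_le_of_avoids {M F : Finset Box} {k : ℕ} (hM : IsMoonPolyomino M)
    (hn : ∀ x ∈ M, x ∈ staircase n) {σ : Perm (Fin n)} (hσ : essentialSet σ = markedBoxes M k)
    (hF : AvoidsNEChains M k F) (p q : ℕ) :
    rk (sticky (M \ F) n (n * n)) p q ≤ rk (toPermNat σ) p q := by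
  refine rk_le_of_essentialSet (fun p q r hr => ?_) p q
  have hp := ((mem_essentialSet_iff.1 hr).1.1.lt (n := n) fun i => toPermNat_apply_of_le σ).1
  rw [rk_sticky (fun x hx => hn x (mem_sdiff.1 hx).1) (by omega)]
  rw [hσ] at hr
  exact (avoidsNEChains_iff hM hF.1).1 hF p q r hr

lemma avoids_sdiff_of_mem {M D : Finset Box} {k : ℕ} (hM : IsMoonPolyomino M)
    {σ : Perm (Fin n)} (hσ : essentialSet σ = markedBoxes M k) (hDM : D ⊆ M)
    (hD : D ∈ reducedPipeDreams σ) : AvoidsNEChains M k (M \ D) := by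
  obtain ⟨hst, -, hw⟩ := mem_reducedPipeDreams_iff.1 hD
  refine (avoidsNEChains_iff hM sdiff_subset).2 fun p q r hr => ?_
  rw [← hσ, mem_essentialSet_iff] at hr
  obtain ⟨hess, rfl⟩ := hr
  have hp := (hess.1.lt (n := n) fun i => toPermNat_apply_of_le σ).1
  rw [Finset.sdiff_sdiff_eq_self hDM, ← hw, rk_sticky hst (by omega)]

end

end MoonFilling

theorem mainTheorem4 (M : Finset MoonFilling.Box) (hM : MoonFilling.IsMoonPolyomino M)
    (k : ℕ) (hk : 0 < k) (n : ℕ) (hn : ∀ x ∈ M, x ∈ MoonFilling.staircase n) :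
    (∃! σ : Equiv.Perm (Fin n),
      MoonFilling.essentialSet σ = MoonFilling.markedBoxes M k) ∧
    ∀ σ : Equiv.Perm (Fin n), MoonFilling.essentialSet σ = MoonFilling.markedBoxes M k →
      Set.BijOn (fun F : Finset MoonFilling.Box => M \ F)
        (MoonFilling.neFillings M k) (MoonFilling.reducedPipeDreamsInside σ M) := by
  open MoonFilling Finset in
  -- the erosion of `M` is a reduced pipe dream whose permutation has the required essential set
  have hn' : ∀ x ∈ erosion M k, x ∈ staircase n := fun x hx => hn x (erosion_subset hx)
  obtain ⟨σ₀, hσ₀⟩ := exists_toPermNat_eq (n := n) (w := sticky (erosion M k) n (n * n))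
    fun i hi => sticky_apply_of_le hn' _ hi
  have hess : essentialSet σ₀ = markedBoxes M k := by
    rw [← markedBoxes_erosion]
    ext ⟨⟨p, q⟩, r⟩
    rw [mem_essentialSet_iff, hσ₀]
    exact hM.erosion.isEssential_iff hn' p q r
  have hred : erosion M k ∈ reducedPipeDreams σ₀ :=
    mem_reducedPipeDreams_iff.2 ⟨hn', hM.erosion.ascending hn', hσ₀.symm⟩
  refine ⟨⟨σ₀, hess, fun τ hτ => essentialSet_injective (hτ.trans hess.symm)⟩, fun σ hσ => ?_⟩
  obtain rfl : σ = σ₀ := essentialSet_injective (hσ.trans hess.symm)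
  have hcard := card_inversions_of_mem hred
  have hsub : ∀ F, ∀ x ∈ M \ F, x ∈ staircase n := fun F x hx => hn x (mem_sdiff.1 hx).1
  refine ⟨fun F hF => ?_, fun F hF G hG h => ?_, fun D hD => ?_⟩
  · obtain ⟨hF, hmax⟩ := hF
    obtain ⟨h1, h2⟩ := card_le_of_rk_le (hsub F) (rk_sticky_le_of_avoids hM hn hσ hF)
    refine ⟨h2 (le_antisymm h1 ?_), sdiff_subset⟩
    have h3 := hmax _ (avoidsNEChains_sdiff_erosion (k := k))
    have h4 := card_sdiff_add_card_eq_card hF.1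
    have h5 := card_sdiff_add_card_eq_card (erosion_subset (M := M) (k := k))
    omega
  · have h' : M \ F = M \ G := h
    rw [← Finset.sdiff_sdiff_eq_self hF.1.1, h', Finset.sdiff_sdiff_eq_self hG.1.1]
  · obtain ⟨hD, hDM⟩ := hD
    refine ⟨M \ D, ⟨avoids_sdiff_of_mem hM hσ hDM hD, fun G hG => ?_⟩,
      Finset.sdiff_sdiff_eq_self hDM⟩
    have h1 := (card_le_of_rk_le (hsub G) (rk_sticky_le_of_avoids hM hn hσ hG)).1
    have h2 := card_inversions_of_mem hD
    have h4 := card_sdiff_add_card_eq_card hG.1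
    have h5 := card_sdiff_add_card_eq_card hDM
    omega
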